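/- Let $a<b$, let $\gamma\in C^\infty([a,b];\mathbb R^3)$ be parametrized by arc-length, $|\gamma'|\equiv 1$, with unit tangent $T=\gamma'$, and let $\varrho\in C^\infty([a,b];\mathbb R_{>0})$ be its bending stiffness. For a regular curve $\gamma$, with $\tfrac{d}{ds}=\tfrac{1}{|\gamma'|}\tfrac{d}{dx}$, $ds=|\gamma'|\,dx$ and $T=\tfrac{d\gamma}{ds}$, the bending energy is $\mathcal B_\varrho(\gamma)=\tfrac12\int_a^b\varrho\,\langle \tfrac{dT}{ds},\tfrac{dT}{ds}\rangle\,ds$. A parallel normal field along $\gamma$ is a smooth $Z:[a,b]\to\mathbb R^3$ with $\langle Z,T\rangle=0$ and $Z'=\lambda T$ for some smooth function $\lambda$. For unit vectors $W_a\perp T(a)$, $W_b\perp T(b)$, the holonomy $\mathcal T_W(\gamma)\in\mathbb R/2\pi\mathbb Z$ is the angle with $Z(b)=\cos(\mathcal T_W)W_b+\sin(\mathcal T_W)\,T(b)\times W_b$, where $Z$ is the parallel normal field with $Z(a)=W_a$. The curve $\gamma$ is called *holonomy constrained elastic* if $\tfrac{d}{dt}\big|_{t=0}\mathcal B_\varrho(\gamma_t)=0$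 for every smooth variation $(t,x)\mapsto\gamma_t(x)$ of $\gamma=\gamma_0$ through regular curves, $t\in[-\epsilon,\epsilon]$, with compact support in the interior of $[a,b]$ (that is, $\gamma_t=\gamma$ near $a$ and $b$, uniformly in $t$), whose variational vector field respects the constraints on arc-length and holonomy, i.e. $\tfrac{d}{dt}\big|_{t=0}|\gamma_t'(x)|=0$ for all $x\in[a,b]$ and $\tfrac{d}{dt}\big|_{t=0}\mathcal T_W(\gamma_t)=0$ for all $W=(W_a,W_b)$. Then the following statements are equivalent: 1. $\gamma$ is a holonomy constrained elastic curve. 2. There are a smooth function $\Lambda:[a,b]\to\mathbb R$ and constants $\mu\in\mathbb R$, $\mathbf a\in\mathbb R^3$ such that $$\varrho T''+\tfrac32\varrho\langle T',T'\rangle T+\varrho' T'-\Lambda T-\mu\,T\times T'+\mathbf a=0.$$ 3. There are constants $\mu\in\mathbb R$, $\mathbf a\in\mathbb R^3$ such that $$\varrho T''-\varrho\langle T'',T\rangle T+\varrho' T'+\mathbf a-\langle\mathbf a,T\rangle T-\mu\,T\times T'=0.$$ 4. There are constants $\mu\in\mathbb R$, $\mathbf a,\mathbf b\in\mathbb R^3$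 such that $$\varrho(\gamma'\times\gamma'')=-\mu T+\mathbf a\times\gamma+\mathbf b.$$ 5. There are constants $\mathbf a,\mathbf b\in\mathbb R^3$ such that $$\varrho\gamma''=(\mathbf a\times\gamma+\mathbf b)\times\gamma'.$$ -/

import Mathlib

open Set Filter
open scoped ContDiff Topology

namespace ElasticCurve

/-- Euclidean three-space. -/
abbrev E3 : Type := EuclideanSpace ℝ (Fin 3)

/-- The cross product of Euclidean three-space. -/
def cross (u v : E3) : E3 := WithLp.toLp 2 (crossProduct (WithLp.ofLp u) (WithLp.ofLp v))

variable {F : Type*} [NormedAddCommGroup F] [NormedSpace ℝ F]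

/-- `f ∈ C^∞([a,b]; F)`. Only the values on `[a,b]` matter. -/
def SmoothOnIcc (a b : ℝ) (f : ℝ → F) : Prop := ContDiffOn ℝ ∞ f (Icc a b)

/-- The derivative `f'` of a function on `[a,b]` (one-sided at the end points). -/
noncomputable def D (a b : ℝ) (f : ℝ → F) : ℝ → F := derivWithin f (Icc a b)

/-- A curve: a smooth map `γ : [a,b] → ℝ³` with `γ' ≠ 0`. -/
def IsCurve (a b : ℝ) (γ : ℝ → E3) : Prop :=
  SmoothOnIcc a b γ ∧ ∀ x ∈ Icc a b, D a b γ x ≠ 0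

/-- The curve is parametrized by arc-length: `|γ'| ≡ 1`. -/
def IsArcLengthParam (a b : ℝ) (γ : ℝ → E3) : Prop :=
  ∀ x ∈ Icc a b, ‖D a b γ x‖ = 1

/-- A bending stiffness: a smooth function `ϱ : [a,b] → ℝ_{>0}`. -/
def IsBendingStiffness (a b : ℝ) (ϱ : ℝ → ℝ) : Prop :=
  SmoothOnIcc a b ϱ ∧ ∀ x ∈ Icc a b, 0 < ϱ x

/-- The derivative with respect to the arc-length of `γ`: `dg/ds = g' / |γ'|`. -/
noncomputable def arcDeriv (a b : ℝ) (γ : ℝ → E3) (g : ℝ → F) : ℝ → F :=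
  fun x => ‖D a b γ x‖⁻¹ • D a b g x

/-- The unit tangent field `T = dγ/ds`. -/
noncomputable def unitTangent (a b : ℝ) (γ : ℝ → E3) : ℝ → E3 := arcDeriv a b γ γ

/-- The bending energy `½ ∫_a^b ϱ ⟨dT/ds, dT/ds⟩ ds`, where `ds = |γ'| dx`. -/
noncomputable def bendingEnergy (a b : ℝ) (ϱ : ℝ → ℝ) (γ : ℝ → E3) : ℝ :=
  (1 / 2) * ∫ x in a..b,
    ϱ x * inner ℝ (arcDeriv a b γ (unitTangent a b γ) x) (arcDeriv a b γ (unitTangent a b γ) x) *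
      ‖D a b γ x‖

/-- `Z` is a parallel normal field along `γ`: `⟨Z, T⟩ = 0` and `Z' = l T` for a smooth `l`. -/
def IsParallelNormalField (a b : ℝ) (γ Z : ℝ → E3) : Prop :=
  SmoothOnIcc a b Z ∧
  (∀ x ∈ Icc a b, inner ℝ (Z x) (unitTangent a b γ x) = 0) ∧
  ∃ l : ℝ → ℝ, SmoothOnIcc a b l ∧ ∀ x ∈ Icc a b, D a b Z x = l x • unitTangent a b γ x

/-- `v` is a unit vector that is normal to `γ` at `γ(x)`. -/
def IsUnitNormalAt (a b : ℝ) (γ : ℝ → E3) (x : ℝ) (v : E3) : Prop :=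
  ‖v‖ = 1 ∧ inner ℝ v (unitTangent a b γ x) = 0

/-- The angle `θ ∈ ℝ/2πℤ` is the holonomy of `γ` with respect to the pair `(Wa, Wb)` of unit
normal vectors at `a` and `b`: the parallel transport `Z(b)` of `Wa` along `γ` is
`cos θ Wb + sin θ T(b) × Wb`. (Such an angle exists and is unique; it is written as a relation
in order not to need this fact in the definition.) -/
def IsHolonomy (a b : ℝ) (γ : ℝ → E3) (Wa Wb : E3) (θ : Real.Angle) : Prop :=
  ∃ Z : ℝ → E3, IsParallelNormalField a b γ Z ∧ Z a = Wa ∧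
    Z b = θ.cos • Wb + θ.sin • cross (unitTangent a b γ b) Wb

/-- `t ↦ G t`, `t ∈ [-ε, ε]`, is a smooth variation of the curve `γ` through curves, with compact
support in the interior of `[a,b]`. -/
structure IsCompactlySupportedVariation (a b : ℝ) (γ : ℝ → E3) (ε : ℝ) (G : ℝ → ℝ → E3) :
    Prop where
  pos : 0 < ε
  smooth : ContDiffOn ℝ ∞ (fun p : ℝ × ℝ => G p.1 p.2) (Icc (-ε) ε ×ˢ Icc a b)
  isCurve : ∀ t ∈ Icc (-ε) ε, IsCurve a b (G t)
  start : ∀ x ∈ Icc a b, G 0 x = γ x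
  support : ∃ δ > 0, ∀ t ∈ Icc (-ε) ε, ∀ x ∈ Icc a (a + δ) ∪ Icc (b - δ) b,
    x ∈ Icc a b → G t x = γ x

/-- The variation leaves the arc-length element constant to first order at `t = 0`:
`d/dt |γ_t'(x)| = 0` at `t = 0` for all `x`. -/
def ConstrainsArcLength (a b : ℝ) (G : ℝ → ℝ → E3) : Prop :=
  ∀ x ∈ Icc a b, HasDerivAt (fun t => ‖D a b (G t) x‖) 0 0

/-- The variation leaves the holonomy constant to first order at `t = 0`: for each pair `(Wa, Wb)`
of unit normal vectors at the end points the `ℝ/2πℤ`-valued holonomy of `γ_t` has derivative `0`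
at `t = 0`, which is expressed through a real-valued lift `θ`. -/
def ConstrainsHolonomy (a b : ℝ) (G : ℝ → ℝ → E3) : Prop :=
  ∀ Wa Wb : E3, IsUnitNormalAt a b (G 0) a Wa → IsUnitNormalAt a b (G 0) b Wb →
    ∃ θ : ℝ → ℝ, (∀ᶠ t in 𝓝 (0 : ℝ), IsHolonomy a b (G t) Wa Wb (θ t : Real.Angle)) ∧
      HasDerivAt θ 0 0

/-- `γ` with bending stiffness `ϱ` is a holonomy constrained elastic curve: it is a critical point
of the bending energy under all variations with compact support in the interior of `[a,b]` that
constrain the arc-length and the holonomy. A variation enters only through its variational vector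
field `d/dt γ_t` at `t = 0`, and the constraints are imposed on this field. -/
def IsHolonomyConstrainedElastic (a b : ℝ) (ϱ : ℝ → ℝ) (γ : ℝ → E3) : Prop :=
  ∀ (ε : ℝ) (G : ℝ → ℝ → E3), IsCompactlySupportedVariation a b γ ε G →
    ConstrainsArcLength a b G → ConstrainsHolonomy a b G →
      HasDerivAt (fun t => bendingEnergy a b ϱ (G t)) 0 0

end ElasticCurve

open ElasticCurve

namespace ElasticCurve

/-! Let `y` be the variation of the unit tangent. It is normal to `T` and vanishes at the end
points. If arc-length is constrained, `y` is also the variation of `γ'`, so fixed end points force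
`∫ y = 0`, and integration by parts turns the first variation of the energy into `-∫ ⟨(ϱT')', y⟩`
(`hasDerivAt_bendingEnergy`, `integral_bending`).

The variation of the holonomy is `∫ ⟨T × y, T'⟩ = -∫ ⟨T × T', y⟩`, the infinitesimal Gauss-Bonnet
formula on the sphere of tangents. To prove it, a vector `v` parallel to no `T x` is fixed. The
field `v × T / |v × T|` is then a global unit normal, a parallel field is its rotation by minus the
integral of a connection form, and the derivative of that form is an exact term minus the area form
(`connectionForm_curvature`, `constrainsHolonomy_iff`).

Conversely, every normal `y` that vanishes near the end points and satisfies the two integral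
constraints comes from `γ + t ∫ y`; the constraints are of first order, so no correction of this
linear variation is needed. Stationarity therefore says that `y ↦ ∫ ⟨(ϱT')', y⟩` vanishes on the
common kernel of four functionals: the three coordinates of `∫ y` and `∫ ⟨T × T', y⟩`. Linear
algebra makes it a combination of them, with coefficients `-𝐚` and `μ`, and the fundamental lemma of
the calculus of variations yields statement 3.

The rest is vector algebra along the curve. Statement 2 is statement 3 with a free tangential part,
absorbed by `Λ`. The left side of 3 is normal, so it vanishes iff its cross product with `T` does;
that product is the derivative of `ϱ T × T' + μT - 𝐚 × γ`, whose constancy is 4. Crossing 4 with `T`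
gives 5, and `μ` is recovered from 5 as the conserved quantity `⟨𝐚 × γ + 𝐛, T⟩`. -/

@[simp] lemma cross_apply_zero (u v : E3) : cross u v 0 = u 1 * v 2 - u 2 * v 1 := by
  simp [cross, crossProduct]

@[simp] lemma cross_apply_one (u v : E3) : cross u v 1 = u 2 * v 0 - u 0 * v 2 := by
  simp [cross, crossProduct]

@[simp] lemma cross_apply_two (u v : E3) : cross u v 2 = u 0 * v 1 - u 1 * v 0 := by
  simp [cross, crossProduct]

lemma inner_eq_sum (u v : E3) : inner ℝ u v = u 0 * v 0 + u 1 * v 1 + u 2 * v 2 := by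
  simp only [PiLp.inner_apply, Fin.sum_univ_three]
  simp [mul_comm]

lemma ext_coord {u v : E3} (h0 : u 0 = v 0) (h1 : u 1 = v 1) (h2 : u 2 = v 2) : u = v := by
  ext i; fin_cases i <;> assumption

/-- The cross product as a continuous bilinear map. -/
noncomputable def crossL : E3 →L[ℝ] E3 →L[ℝ] E3 :=
  LinearMap.toContinuousLinearMap
    ((LinearMap.toContinuousLinearMap : (E3 →ₗ[ℝ] E3) ≃ₗ[ℝ] (E3 →L[ℝ] E3)).toLinearMap ∘ₗ
      LinearMap.mk₂ ℝ cross
        (fun u v w => ext_coord (by simp; ring) (by simp; ring) (by simp; ring))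
        (fun c u v => ext_coord (by simp; ring) (by simp; ring) (by simp; ring))
        (fun u v w => ext_coord (by simp; ring) (by simp; ring) (by simp; ring))
        (fun c u v => ext_coord (by simp; ring) (by simp; ring) (by simp; ring)))

lemma crossL_apply (u v : E3) : crossL u v = cross u v := rfl

lemma cross_add_left (u v w : E3) : cross (u + v) w = cross u w + cross v w := by
  simp [← crossL_apply]
lemma cross_add_right (u v w : E3) : cross u (v + w) = cross u v + cross u w := by
  simp [← crossL_apply]
lemma cross_sub_right (u v w : E3) : cross u (v - w) = cross u v - cross u w := by
  simp [← crossL_apply]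
lemma cross_smul_left (c : ℝ) (u v : E3) : cross (c • u) v = c • cross u v := by
  simp [← crossL_apply]
lemma cross_smul_right (c : ℝ) (u v : E3) : cross u (c • v) = c • cross u v := by
  simp [← crossL_apply]
@[simp] lemma cross_zero_left (u : E3) : cross 0 u = 0 := by simp [← crossL_apply]
@[simp] lemma cross_zero_right (u : E3) : cross u 0 = 0 := by simp [← crossL_apply]
@[simp] lemma cross_self_eq_zero (u : E3) : cross u u = 0 :=
  ext_coord (by simp; ring) (by simp; ring) (by simp; ring)
lemma cross_comm_neg (u v : E3) : cross u v = -cross v u :=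
  ext_coord (by simp; ring_nf) (by simp; ring_nf) (by simp; ring_nf)
@[simp] lemma inner_cross_self_left (u v : E3) : inner ℝ (cross u v) u = 0 := by
  simp [inner_eq_sum]; ring
@[simp] lemma inner_cross_self_right (u v : E3) : inner ℝ (cross u v) v = 0 := by
  simp [inner_eq_sum]; ring
lemma inner_cross_rotate (u v w : E3) : inner ℝ (cross u v) w = inner ℝ (cross v w) u := by
  simp [inner_eq_sum]; ring
lemma inner_cross_swap (u v w : E3) : inner ℝ (cross u v) w = -inner ℝ (cross v u) w := by
  simp [inner_eq_sum]; ring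
lemma cross_cross_right (u v w : E3) :
    cross u (cross v w) = inner ℝ u w • v - inner ℝ u v • w :=
  ext_coord (by simp [inner_eq_sum]; ring) (by simp [inner_eq_sum]; ring)
    (by simp [inner_eq_sum]; ring)
lemma cross_cross_left (u v w : E3) :
    cross (cross u v) w = inner ℝ u w • v - inner ℝ v w • u :=
  ext_coord (by simp [inner_eq_sum]; ring) (by simp [inner_eq_sum]; ring)
    (by simp [inner_eq_sum]; ring)
lemma inner_cross_cross (u v w z : E3) :
    inner ℝ (cross u v) (cross w z) =
      inner ℝ u w * inner ℝ v z - inner ℝ u z * inner ℝ v w := by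
  simp [inner_eq_sum]; ring

/-- The map `T × (T × ·)` is minus the projection onto the normal plane, so `T × u` determines the
normal part of `u` and `⟨T, u⟩` the tangential part. -/
lemma eq_of_cross_eq_of_inner_eq {T u v : E3} (hT : ‖T‖ = 1) (h : cross T u = cross T v)
    (h' : inner ℝ T u = inner ℝ T v) : u = v := by
  have h1 := congrArg (cross T) h
  simp only [cross_cross_right, real_inner_self_eq_norm_sq, hT, h'] at h1
  simpa using h1

lemma eq_zero_of_inner_frame_eq_zero {T N e : E3} (hT : ‖T‖ = 1) (hN : ‖N‖ = 1)
    (hTN : inner ℝ N T = 0) (h1 : inner ℝ e T = 0) (h2 : inner ℝ e N = 0)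
    (h3 : inner ℝ e (cross T N) = 0) : e = 0 := by
  have hx : cross e (cross N (cross T N)) = 0 := by
    rw [cross_cross_right, h2, h3]; simp
  have hNT : cross N (cross T N) = T := by
    rw [cross_cross_right, real_inner_self_eq_norm_sq, hN, hTN]; simp
  rw [hNT] at hx
  refine eq_of_cross_eq_of_inner_eq hT ?_ ?_
  · rw [cross_comm_neg, hx]; simp
  · rw [real_inner_comm, h1]; simp

lemma _root_.HasDerivWithinAt.cross {u v : ℝ → E3} {u' v' : E3} {s : Set ℝ} {x : ℝ}
    (hu : HasDerivWithinAt u u' s x) (hv : HasDerivWithinAt v v' s x) :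
    HasDerivWithinAt (fun x => cross (u x) (v x)) (cross (u x) v' + cross u' (v x)) s x :=
  crossL.hasDerivWithinAt_of_bilinear hu hv

lemma _root_.HasDerivAt.cross {u v : ℝ → E3} {u' v' : E3} {x : ℝ}
    (hu : HasDerivAt u u' x) (hv : HasDerivAt v v' x) :
    HasDerivAt (fun x => cross (u x) (v x)) (cross (u x) v' + cross u' (v x)) x :=
  hasDerivWithinAt_univ.1 (hu.hasDerivWithinAt.cross hv.hasDerivWithinAt)

lemma _root_.ContDiffOn.cross {E : Type*} [NormedAddCommGroup E] [NormedSpace ℝ E]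
    {u v : E → E3} {s : Set E} {n : ℕ∞ω}
    (hu : ContDiffOn ℝ n u s) (hv : ContDiffOn ℝ n v s) :
    ContDiffOn ℝ n (fun x => cross (u x) (v x)) s :=
  crossL.isBoundedBilinearMap.contDiff.comp_contDiffOn (hu.prodMk hv)

lemma _root_.ContinuousOn.cross {E : Type*} [TopologicalSpace E]
    {u v : E → E3} {s : Set E} (hu : ContinuousOn u s) (hv : ContinuousOn v s) :
    ContinuousOn (fun x => cross (u x) (v x)) s :=
  crossL.isBoundedBilinearMap.continuous.comp_continuousOn (hu.prodMk hv)

/-! ### One-sided calculus on a compact interval. -/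

section Calculus
variable {F : Type*} [NormedAddCommGroup F] [NormedSpace ℝ F] {a b : ℝ}

lemma SmoothOnIcc.derivWithin (hab : a < b) {f : ℝ → F} (hf : SmoothOnIcc a b f) :
    SmoothOnIcc a b (D a b f) :=
  ContDiffOn.derivWithin hf (uniqueDiffOn_Icc hab) (by simp)

lemma SmoothOnIcc.hasDerivWithinAt {f : ℝ → F} (hf : SmoothOnIcc a b f) {x : ℝ}
    (hx : x ∈ Icc a b) : HasDerivWithinAt f (D a b f x) (Icc a b) x :=
  ((ContDiffOn.differentiableOn hf (by simp)) x hx).hasDerivWithinAt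

lemma SmoothOnIcc.continuousOn {f : ℝ → F} (hf : SmoothOnIcc a b f) : ContinuousOn f (Icc a b) :=
  ContDiffOn.continuousOn hf

lemma D_eq (hab : a < b) {f : ℝ → F} {f' : F} {x : ℝ} (hx : x ∈ Icc a b)
    (h : HasDerivWithinAt f f' (Icc a b) x) : D a b f x = f' :=
  h.derivWithin (uniqueDiffOn_Icc hab x hx)

lemma D_congr {f g : ℝ → F} (h : EqOn f g (Icc a b)) : EqOn (D a b f) (D a b g) (Icc a b) :=
  fun _ hx => derivWithin_congr h (h hx)

lemma eq_left_of_hasDerivWithinAt_zero {f : ℝ → F}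
    (h : ∀ x ∈ Icc a b, HasDerivWithinAt f 0 (Icc a b) x) {x : ℝ} (hx : x ∈ Icc a b) :
    f x = f a := by
  rcases hx.1.eq_or_lt with rfl | hlt
  · rfl
  have hab : a < b := hlt.trans_le hx.2
  exact constant_of_derivWithin_zero (fun y hy => (h y hy).differentiableWithinAt)
    (fun y hy => (h y (Ico_subset_Icc_self hy)).derivWithin
      (uniqueDiffOn_Icc hab y (Ico_subset_Icc_self hy))) x hx

end Calculus

/-! ### Equivalence of the differential equations. -/

section UnitField
variable {a b : ℝ} {T : ℝ → E3}

lemma inner_D_self_eq_zero (hab : a < b) (hT : SmoothOnIcc a b T)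
    (h1 : ∀ x ∈ Icc a b, ‖T x‖ = 1) {x : ℝ} (hx : x ∈ Icc a b) :
    inner ℝ (T x) (D a b T x) = 0 := by
  have h := ((hT.hasDerivWithinAt hx).inner ℝ (hT.hasDerivWithinAt hx))
  have h' : HasDerivWithinAt (fun x => inner ℝ (T x) (T x)) (0 : ℝ) (Icc a b) x :=
    (hasDerivWithinAt_const x (Icc a b) (1 : ℝ)).congr
      (fun y hy => by simp [h1 y hy])
      (by simp [h1 x hx])
  have := (uniqueDiffOn_Icc hab x hx).eq_deriv _ h h'
  rw [real_inner_comm (T x) (D a b T x)] at this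
  rw [real_inner_comm] at this ⊢
  linarith

lemma inner_D_D_self (hab : a < b) (hT : SmoothOnIcc a b T)
    (h1 : ∀ x ∈ Icc a b, ‖T x‖ = 1) {x : ℝ} (hx : x ∈ Icc a b) :
    inner ℝ (D a b (D a b T) x) (T x) = -inner ℝ (D a b T x) (D a b T x) := by
  have h := ((hT.hasDerivWithinAt hx).inner ℝ ((hT.derivWithin hab).hasDerivWithinAt hx))
  have h' : HasDerivWithinAt (fun x => inner ℝ (T x) (D a b T x)) (0 : ℝ) (Icc a b) x :=
    (hasDerivWithinAt_const x (Icc a b) (0 : ℝ)).congr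
      (fun y hy => inner_D_self_eq_zero hab hT h1 hy) (inner_D_self_eq_zero hab hT h1 hx)
  have := (uniqueDiffOn_Icc hab x hx).eq_deriv _ h h'
  rw [real_inner_comm]
  linarith

/-- The tangential part of the Euler-Lagrange equation determines the multiplier. -/
lemma euler_lagrange_iff_normal_part (hab : a < b) (hT : SmoothOnIcc a b T)
    (h1 : ∀ x ∈ Icc a b, ‖T x‖ = 1) {ϱ : ℝ → ℝ} (hϱ : SmoothOnIcc a b ϱ) :
    (∃ (Λ : ℝ → ℝ) (μ : ℝ) (α : E3), SmoothOnIcc a b Λ ∧ ∀ x ∈ Icc a b,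
        ϱ x • D a b (D a b T) x
          + ((3 / 2 : ℝ) * ϱ x * inner ℝ (D a b T x) (D a b T x)) • T x
          + D a b ϱ x • D a b T x - Λ x • T x - μ • cross (T x) (D a b T x) + α = 0) ↔
      ∃ (μ : ℝ) (α : E3), ∀ x ∈ Icc a b,
        ϱ x • D a b (D a b T) x
          - (ϱ x * inner ℝ (D a b (D a b T) x) (T x)) • T x
          + D a b ϱ x • D a b T x + α - inner ℝ α (T x) • T x
          - μ • cross (T x) (D a b T x) = 0 := by
  constructor
  · rintro ⟨Λ, μ, α, -, h⟩
    refine ⟨μ, α, fun x hx => ?_⟩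
    have hx0 := h x hx
    have hi := congrArg (fun u => inner ℝ u (T x)) hx0
    have hTT : inner ℝ (T x) (T x) = (1 : ℝ) := by simp [h1 x hx]
    have hT0 : inner ℝ (D a b T x) (T x) = (0 : ℝ) := by
      rw [real_inner_comm]; exact inner_D_self_eq_zero hab hT h1 hx
    simp only [inner_add_left, inner_sub_left, real_inner_smul_left, hTT, hT0,
      inner_cross_self_left, inner_zero_left] at hi
    have e : Λ x = ϱ x * inner ℝ (D a b (D a b T) x) (T x)
        + (3 / 2 : ℝ) * ϱ x * inner ℝ (D a b T x) (D a b T x) + inner ℝ α (T x) := by linarith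
    rw [e] at hx0
    rw [← hx0]
    module
  · rintro ⟨μ, α, h⟩
    -- Since `⟨T'', T⟩ = -⟨T', T'⟩`, the tangential coefficients differ by `3/2 - 1 = 1/2` times
    -- `ϱ⟨T', T'⟩`.
    refine ⟨fun x => (1 / 2) * (ϱ x * inner ℝ (D a b T x) (D a b T x)) + inner ℝ α (T x), μ, α,
      ?_, fun x hx => ?_⟩
    · have hT' := hT.derivWithin hab
      exact (contDiffOn_const.mul (ContDiffOn.mul hϱ (ContDiffOn.inner ℝ hT' hT'))).add
        (contDiffOn_const.inner ℝ hT)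
    · rw [← h x hx, inner_D_D_self hab hT h1 hx]
      module

/-- The cross product with the tangent of the normal part of the Euler-Lagrange equation is a
total derivative. -/
lemma normal_part_iff_first_integral (hab : a < b) (hT : SmoothOnIcc a b T)
    (h1 : ∀ x ∈ Icc a b, ‖T x‖ = 1) {ϱ : ℝ → ℝ} (hϱ : SmoothOnIcc a b ϱ) {γ : ℝ → E3}
    (hγ : ∀ x ∈ Icc a b, HasDerivWithinAt γ (T x) (Icc a b) x) (μ : ℝ) (α : E3) :
    (∀ x ∈ Icc a b,
        ϱ x • D a b (D a b T) x
          - (ϱ x * inner ℝ (D a b (D a b T) x) (T x)) • T x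
          + D a b ϱ x • D a b T x + α - inner ℝ α (T x) • T x
          - μ • cross (T x) (D a b T x) = 0) ↔
      ∃ β : E3, ∀ x ∈ Icc a b,
        ϱ x • cross (T x) (D a b T x) = -(μ • T x) + cross α (γ x) + β := by
  have hT' := hT.derivWithin hab
  set E : ℝ → E3 := fun x => ϱ x • D a b (D a b T) x
          - (ϱ x * inner ℝ (D a b (D a b T) x) (T x)) • T x
          + D a b ϱ x • D a b T x + α - inner ℝ α (T x) • T x
          - μ • cross (T x) (D a b T x) with hE
  set M : ℝ → E3 := fun x => ϱ x • cross (T x) (D a b T x) - (-(μ • T x) + cross α (γ x)) with hM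
  have hT0 : ∀ x ∈ Icc a b, inner ℝ (T x) (D a b T x) = (0 : ℝ) :=
    fun x hx => inner_D_self_eq_zero hab hT h1 hx
  have hd : ∀ x ∈ Icc a b, HasDerivWithinAt M (cross (T x) (E x)) (Icc a b) x := by
    intro x hx
    have h := ((hϱ.hasDerivWithinAt hx).smul
      ((hT.hasDerivWithinAt hx).cross (hT'.hasDerivWithinAt hx))).sub
      ((((hT.hasDerivWithinAt hx).const_smul μ).neg).add
        ((hasDerivWithinAt_const x (Icc a b) α).cross (hγ x hx)))
    refine h.congr_deriv ?_
    have e2 : cross α (T x) = - cross (T x) α := cross_comm_neg _ _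
    simp only [hE, cross_add_right, cross_sub_right, cross_smul_right, cross_self_eq_zero,
      cross_cross_right, hT0 x hx, real_inner_self_eq_norm_sq, h1 x hx, e2, cross_zero_left]
    module
  have hEt : ∀ x ∈ Icc a b, inner ℝ (T x) (E x) = (0 : ℝ) := by
    intro x hx
    have hTT : inner ℝ (T x) (T x) = (1 : ℝ) := by simp [h1 x hx]
    simp only [hE, inner_add_right, inner_sub_right, real_inner_smul_right, hTT, hT0 x hx]
    rw [real_inner_comm (cross _ _), inner_cross_self_left, real_inner_comm (T x) α,
      real_inner_comm (T x) (D a b (D a b T) x)]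
    ring
  constructor
  · intro h
    -- Here `M' = T × E = 0`, so `M` is constant and its value is the vector `β`.
    refine ⟨M a, fun x hx => ?_⟩
    have := eq_left_of_hasDerivWithinAt_zero (f := M) (fun y hy => by
      have h2 := hd y hy
      rw [show E y = 0 from h y hy, cross_zero_right] at h2
      exact h2) hx
    rw [← this]
    simp only [hM]
    abel
  · rintro ⟨β, h⟩ x hx
    have hc : HasDerivWithinAt M 0 (Icc a b) x := by
      refine (hasDerivWithinAt_const x (Icc a b) β).congr (fun y hy => ?_) ?_
      · simp only [hM, h y hy]; abel
      · simp only [hM, h x hx]; abel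
    have h0 := (uniqueDiffOn_Icc hab x hx).eq_deriv _ (hd x hx) hc
    refine eq_of_cross_eq_of_inner_eq (u := E x) (h1 x hx) (by rw [h0]; simp) ?_
    rw [hEt x hx]; simp

/-- Crossing with `T` on the right removes the `μ` term and turns `T × T'` into `T'`. In the other
direction `μ` has to be produced as a constant of motion. -/
lemma first_integral_iff_rotation (hab : a < b) (hT : SmoothOnIcc a b T)
    (h1 : ∀ x ∈ Icc a b, ‖T x‖ = 1) {ϱ : ℝ → ℝ} (hϱ : ∀ x ∈ Icc a b, 0 < ϱ x) {γ : ℝ → E3}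
    (hγ : ∀ x ∈ Icc a b, HasDerivWithinAt γ (T x) (Icc a b) x) (α β : E3) :
    (∃ μ : ℝ, ∀ x ∈ Icc a b,
        ϱ x • cross (T x) (D a b T x) = -(μ • T x) + cross α (γ x) + β) ↔
      ∀ x ∈ Icc a b, ϱ x • D a b T x = cross (cross α (γ x) + β) (T x) := by
  have hT0 : ∀ x ∈ Icc a b, inner ℝ (T x) (D a b T x) = (0 : ℝ) :=
    fun x hx => inner_D_self_eq_zero hab hT h1 hx
  constructor
  · rintro ⟨μ, h⟩ x hx
    have h2 := congrArg (fun u => cross u (T x)) (h x hx)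
    simp only [cross_smul_left, cross_cross_left, hT0 x hx, real_inner_comm (T x) (D a b T x),
      real_inner_self_eq_norm_sq, h1 x hx] at h2
    have e : -(μ • T x) + cross α (γ x) + β = (-μ) • T x + (cross α (γ x) + β) := by module
    rw [e, cross_add_left, cross_smul_left, cross_self_eq_zero] at h2
    simpa using h2
  · intro h
    set V : ℝ → E3 := fun x => cross α (γ x) + β with hV
    -- `⟨V, T⟩` is conserved: `V' = α × T` is orthogonal to `T`, and `T'` is a multiple of `V × T`,
    -- hence orthogonal to `V`.
    have hd : ∀ x ∈ Icc a b, HasDerivWithinAt (fun x => inner ℝ (V x) (T x)) (0 : ℝ)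
        (Icc a b) x := by
      intro x hx
      have hVd : HasDerivWithinAt V (cross α (T x)) (Icc a b) x := by
        exact (((hasDerivWithinAt_const x (Icc a b) α).cross (hγ x hx)).add_const β).congr_deriv
          (by simp)
      refine (hVd.inner ℝ (hT.hasDerivWithinAt hx)).congr_deriv ?_
      have e : D a b T x = (ϱ x)⁻¹ • cross (V x) (T x) := by
        rw [← h x hx, smul_smul, inv_mul_cancel₀ (hϱ x hx).ne', one_smul]
      rw [e, real_inner_smul_right, real_inner_comm, inner_cross_self_left,
        inner_cross_self_right]
      simp
    refine ⟨inner ℝ (V a) (T a), fun x hx => ?_⟩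
    have hc := eq_left_of_hasDerivWithinAt_zero hd hx
    rw [← hc, ← cross_smul_right, h x hx, cross_cross_right, real_inner_self_eq_norm_sq, h1 x hx,
      real_inner_comm]
    simp only [hV]
    module

end UnitField

/-! ### Partial derivatives on a time-space rectangle. -/

section Rectangle
variable {F : Type*} [NormedAddCommGroup F] [NormedSpace ℝ F] {a b c d : ℝ}

/-- The partial derivative in the first variable of a function on `[c,d] × [a,b]`. -/
noncomputable def partialFst (c d a b : ℝ) (H : ℝ × ℝ → F) (p : ℝ × ℝ) : F :=
  fderivWithin ℝ H (Icc c d ×ˢ Icc a b) p (1, 0)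

/-- The partial derivative in the second variable of a function on `[c,d] × [a,b]`. -/
noncomputable def partialSnd (c d a b : ℝ) (H : ℝ × ℝ → F) (p : ℝ × ℝ) : F :=
  fderivWithin ℝ H (Icc c d ×ˢ Icc a b) p (0, 1)

lemma uniqueDiffOn_rectangle (hcd : c < d) (hab : a < b) :
    UniqueDiffOn ℝ (Icc c d ×ˢ Icc a b) :=
  (uniqueDiffOn_Icc hcd).prod (uniqueDiffOn_Icc hab)

lemma contDiffOn_fderivWithin_apply (hcd : c < d) (hab : a < b) {H : ℝ × ℝ → F}
    (hH : ContDiffOn ℝ ∞ H (Icc c d ×ˢ Icc a b)) (v : ℝ × ℝ) :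
    ContDiffOn ℝ ∞ (fun p => fderivWithin ℝ H (Icc c d ×ˢ Icc a b) p v) (Icc c d ×ˢ Icc a b) :=
  (hH.fderivWithin (uniqueDiffOn_rectangle hcd hab) (by simp)).clm_apply contDiffOn_const

lemma contDiffOn_partialFst (hcd : c < d) (hab : a < b) {H : ℝ × ℝ → F}
    (hH : ContDiffOn ℝ ∞ H (Icc c d ×ˢ Icc a b)) :
    ContDiffOn ℝ ∞ (partialFst c d a b H) (Icc c d ×ˢ Icc a b) :=
  contDiffOn_fderivWithin_apply hcd hab hH _

lemma contDiffOn_partialSnd (hcd : c < d) (hab : a < b) {H : ℝ × ℝ → F}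
    (hH : ContDiffOn ℝ ∞ H (Icc c d ×ˢ Icc a b)) :
    ContDiffOn ℝ ∞ (partialSnd c d a b H) (Icc c d ×ˢ Icc a b) :=
  contDiffOn_fderivWithin_apply hcd hab hH _

lemma hasDerivWithinAt_partialFst {H : ℝ × ℝ → F}
    (hH : ContDiffOn ℝ ∞ H (Icc c d ×ˢ Icc a b)) {t x : ℝ} (ht : t ∈ Icc c d)
    (hx : x ∈ Icc a b) :
    HasDerivWithinAt (fun s => H (s, x)) (partialFst c d a b H (t, x)) (Icc c d) t := by
  have h := ((hH.differentiableOn (by simp)) (t, x) ⟨ht, hx⟩).hasFDerivWithinAt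
  have hg : HasDerivWithinAt (fun s : ℝ => (s, x)) ((1 : ℝ), (0 : ℝ)) (Icc c d) t :=
    (hasDerivWithinAt_id t _).prodMk (hasDerivWithinAt_const t _ x)
  exact h.comp_hasDerivWithinAt t hg (fun _ hs => mk_mem_prod hs hx)

lemma hasDerivAt_partialFst {H : ℝ × ℝ → F}
    (hH : ContDiffOn ℝ ∞ H (Icc c d ×ˢ Icc a b)) {t x : ℝ} (ht : t ∈ Ioo c d)
    (hx : x ∈ Icc a b) :
    HasDerivAt (fun s => H (s, x)) (partialFst c d a b H (t, x)) t :=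
  (hasDerivWithinAt_partialFst hH (Ioo_subset_Icc_self ht) hx).hasDerivAt
    (Icc_mem_nhds ht.1 ht.2)

lemma hasDerivWithinAt_partialSnd {H : ℝ × ℝ → F}
    (hH : ContDiffOn ℝ ∞ H (Icc c d ×ˢ Icc a b)) {t x : ℝ} (ht : t ∈ Icc c d)
    (hx : x ∈ Icc a b) :
    HasDerivWithinAt (fun y => H (t, y)) (partialSnd c d a b H (t, x)) (Icc a b) x := by
  have h := ((hH.differentiableOn (by simp)) (t, x) ⟨ht, hx⟩).hasFDerivWithinAt
  have hg : HasDerivWithinAt (fun y : ℝ => (t, y)) ((0 : ℝ), (1 : ℝ)) (Icc a b) x :=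
    (hasDerivWithinAt_const x _ t).prodMk (hasDerivWithinAt_id x _)
  exact h.comp_hasDerivWithinAt x hg (fun _ hs => mk_mem_prod ht hs)

lemma partialSnd_eq_D (hab : a < b) {H : ℝ × ℝ → F}
    (hH : ContDiffOn ℝ ∞ H (Icc c d ×ˢ Icc a b)) {t x : ℝ} (ht : t ∈ Icc c d)
    (hx : x ∈ Icc a b) : partialSnd c d a b H (t, x) = D a b (fun y => H (t, y)) x :=
  (D_eq hab hx (hasDerivWithinAt_partialSnd hH ht hx)).symm

lemma smoothOnIcc_slice {H : ℝ × ℝ → F} (hH : ContDiffOn ℝ ∞ H (Icc c d ×ˢ Icc a b)) {t : ℝ}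
    (ht : t ∈ Icc c d) : SmoothOnIcc a b (fun x => H (t, x)) :=
  hH.comp (contDiffOn_const.prodMk contDiffOn_id) (fun _ hx => ⟨ht, hx⟩)

lemma partialFst_partialSnd (hcd : c < d) (hab : a < b) {H : ℝ × ℝ → F}
    (hH : ContDiffOn ℝ ∞ H (Icc c d ×ˢ Icc a b)) {p : ℝ × ℝ} (hp : p ∈ Icc c d ×ˢ Icc a b) :
    partialFst c d a b (partialSnd c d a b H) p = partialSnd c d a b (partialFst c d a b H) p := by
  have hu := uniqueDiffOn_rectangle hcd hab
  have hd : DifferentiableWithinAt ℝ (fderivWithin ℝ H (Icc c d ×ˢ Icc a b))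
      (Icc c d ×ˢ Icc a b) p :=
    ((hH.fderivWithin hu (m := ∞) (by simp)).differentiableOn (by simp)) p hp
  have key : ∀ v w : ℝ × ℝ, fderivWithin ℝ
      (fun q => fderivWithin ℝ H (Icc c d ×ˢ Icc a b) q v) (Icc c d ×ˢ Icc a b) p w =
      fderivWithin ℝ (fderivWithin ℝ H (Icc c d ×ˢ Icc a b)) (Icc c d ×ˢ Icc a b) p w v := by
    intro v w
    have h := hd.hasFDerivWithinAt.clm_apply (hasFDerivWithinAt_const v p (Icc c d ×ˢ Icc a b))
    rw [h.fderivWithin (hu p hp)]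
    simp
  -- Symmetry also holds at boundary points, because the rectangle is the closure of its interior.
  have hs : IsSymmSndFDerivWithinAt ℝ H (Icc c d ×ˢ Icc a b) p := by
    refine (hH p hp).isSymmSndFDerivWithinAt 
      (by rw [minSmoothness_of_isRCLikeNormedField]
          exact WithTop.coe_le_coe.2 (le_top : (2 : ℕ∞) ≤ ⊤)) hu ?_ hp
    rw [interior_prod_eq, interior_Icc, interior_Icc, closure_prod_eq, closure_Ioo hcd.ne,
      closure_Ioo hab.ne]
    exact hp
  exact (key _ _).trans ((hs.eq _ _).trans (key _ _).symm)

lemma hasDerivAt_integral_partialFst (hcd : c < d) (hab : a < b) {H : ℝ × ℝ → F}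
    (hH : ContDiffOn ℝ ∞ H (Icc c d ×ˢ Icc a b)) {t : ℝ} (ht : t ∈ Ioo c d) :
    HasDerivAt (fun s => ∫ x in a..b, H (s, x)) (∫ x in a..b, partialFst c d a b H (t, x)) t := by
  have hH' := contDiffOn_partialFst hcd hab hH
  obtain ⟨C, hC⟩ := (isCompact_Icc.prod isCompact_Icc).exists_bound_of_continuousOn
    hH'.continuousOn
  have hm : ∀ s ∈ Icc c d, ∀ K : ℝ × ℝ → F, ContDiffOn ℝ ∞ K (Icc c d ×ˢ Icc a b) →
      IntervalIntegrable (fun x => K (s, x)) MeasureTheory.volume a b := fun s hs K hK =>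
    ContinuousOn.intervalIntegrable (by
      rw [uIcc_of_le hab.le]; exact (smoothOnIcc_slice hK hs).continuousOn)
  have hsub : ∀ x ∈ uIoc a b, x ∈ Icc a b := by
    intro x hx
    rw [uIoc_of_le hab.le] at hx
    exact Ioc_subset_Icc_self hx
  refine (intervalIntegral.hasDerivAt_integral_of_dominated_loc_of_deriv_le
    (F := fun s x => H (s, x)) (F' := fun s x => partialFst c d a b H (s, x))
    (bound := fun _ => C) (s := Ioo c d) (Ioo_mem_nhds ht.1 ht.2) ?_
    (hm t (Ioo_subset_Icc_self ht) H hH) ?_ ?_ intervalIntegrable_const ?_).2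
  · filter_upwards [Ioo_mem_nhds ht.1 ht.2] with s hs
    exact (hm s (Ioo_subset_Icc_self hs) H hH).def'.aestronglyMeasurable
  · exact (hm t (Ioo_subset_Icc_self ht) _ hH').def'.aestronglyMeasurable
  · exact Eventually.of_forall fun x hx s hs => hC _ ⟨Ioo_subset_Icc_self hs, hsub x hx⟩
  · exact Eventually.of_forall fun x hx s hs => hasDerivAt_partialFst hH hs (hsub x hx)

end Rectangle

lemma integral_D {F : Type*} [NormedAddCommGroup F] [NormedSpace ℝ F] [CompleteSpace F]
    {a b : ℝ} (hab : a < b) {f : ℝ → F} (hf : SmoothOnIcc a b f) :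
    ∫ x in a..b, D a b f x = f b - f a := by
  refine intervalIntegral.integral_eq_sub_of_hasDerivAt_of_le hab.le hf.continuousOn
    (fun x hx => (hf.hasDerivWithinAt (Ioo_subset_Icc_self hx)).hasDerivAt
      (Icc_mem_nhds hx.1 hx.2)) ?_
  refine ContinuousOn.intervalIntegrable ?_
  rw [uIcc_of_le hab.le]
  exact (hf.derivWithin hab).continuousOn

/-! ### Unit tangents of regular curves. -/

section Curve
variable {a b : ℝ} {γ : ℝ → E3}

lemma IsCurve.norm_unitTangent (h : IsCurve a b γ) {x : ℝ} (hx : x ∈ Icc a b) :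
    ‖unitTangent a b γ x‖ = 1 := by
  have := norm_ne_zero_iff.2 (h.2 x hx)
  simp only [unitTangent, arcDeriv, norm_smul, norm_inv, norm_norm]
  exact inv_mul_cancel₀ this

lemma IsCurve.smoothOnIcc_unitTangent (hab : a < b) (h : IsCurve a b γ) :
    SmoothOnIcc a b (unitTangent a b γ) := by
  have hD : SmoothOnIcc a b (D a b γ) := h.1.derivWithin hab
  exact ((ContDiffOn.norm ℝ hD h.2).inv fun x hx => norm_ne_zero_iff.2 (h.2 x hx)).smul hD

lemma norm_smul_unitTangent (γ : ℝ → E3) (x : ℝ) (h : D a b γ x ≠ 0) :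
    ‖D a b γ x‖ • unitTangent a b γ x = D a b γ x := by
  simp only [unitTangent, arcDeriv, smul_smul]
  rw [mul_inv_cancel₀ (norm_ne_zero_iff.2 h), one_smul]

lemma unitTangent_congr {c : ℝ → E3} (h : EqOn γ c (Icc a b)) :
    EqOn (unitTangent a b γ) (unitTangent a b c) (Icc a b) := fun x hx => by
  simp only [unitTangent, arcDeriv, D_congr h hx]

lemma unitTangent_eq_D (hs : IsArcLengthParam a b γ) :
    EqOn (unitTangent a b γ) (D a b γ) (Icc a b) := fun x hx => by
  simp [unitTangent, arcDeriv, hs x hx]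

end Curve

/-! ### First variation of the tangent and of the bending energy. -/

section Variation
variable {a b ε : ℝ} {γ : ℝ → E3} {G : ℝ → ℝ → E3}

/-- The derivative of the unit tangent field along a variation at time zero. -/
noncomputable def tangentVariation (a b ε : ℝ) (G : ℝ → ℝ → E3) (x : ℝ) : E3 :=
  partialFst (-ε) ε a b (fun p => unitTangent a b (G p.1) p.2) (0, x)

namespace IsCompactlySupportedVariation

lemma zero_mem (h : IsCompactlySupportedVariation a b γ ε G) : (0 : ℝ) ∈ Ioo (-ε) ε :=
  ⟨by linarith [h.pos], h.pos⟩

lemma neg_lt (h : IsCompactlySupportedVariation a b γ ε G) : -ε < ε := by linarith [h.pos]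

lemma zero_mem_Icc (h : IsCompactlySupportedVariation a b γ ε G) : (0 : ℝ) ∈ Icc (-ε) ε :=
  Ioo_subset_Icc_self h.zero_mem

lemma contDiffOn_velocity (h : IsCompactlySupportedVariation a b γ ε G) (hab : a < b) :
    ContDiffOn ℝ ∞ (fun p : ℝ × ℝ => D a b (G p.1) p.2) (Icc (-ε) ε ×ˢ Icc a b) :=
  (contDiffOn_partialSnd h.neg_lt hab h.smooth).congr fun _ hp =>
    (partialSnd_eq_D hab h.smooth hp.1 hp.2).symm

lemma contDiffOn_speed (h : IsCompactlySupportedVariation a b γ ε G) (hab : a < b) :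
    ContDiffOn ℝ ∞ (fun p : ℝ × ℝ => ‖D a b (G p.1) p.2‖) (Icc (-ε) ε ×ˢ Icc a b) :=
  (h.contDiffOn_velocity hab).norm ℝ fun p hp => (h.isCurve p.1 hp.1).2 p.2 hp.2

lemma contDiffOn_inv_speed (h : IsCompactlySupportedVariation a b γ ε G) (hab : a < b) :
    ContDiffOn ℝ ∞ (fun p : ℝ × ℝ => ‖D a b (G p.1) p.2‖⁻¹) (Icc (-ε) ε ×ˢ Icc a b) :=
  (h.contDiffOn_speed hab).inv fun p hp =>
    norm_ne_zero_iff.2 ((h.isCurve p.1 hp.1).2 p.2 hp.2)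

lemma contDiffOn_tangent (h : IsCompactlySupportedVariation a b γ ε G) (hab : a < b) :
    ContDiffOn ℝ ∞ (fun p : ℝ × ℝ => unitTangent a b (G p.1) p.2) (Icc (-ε) ε ×ˢ Icc a b) :=
  (h.contDiffOn_inv_speed hab).smul (h.contDiffOn_velocity hab)

lemma smoothOnIcc_tangentVariation (h : IsCompactlySupportedVariation a b γ ε G) (hab : a < b) :
    SmoothOnIcc a b (tangentVariation a b ε G) :=
  smoothOnIcc_slice (contDiffOn_partialFst h.neg_lt hab (h.contDiffOn_tangent hab))
    h.zero_mem_Icc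

lemma hasDerivAt_tangent (h : IsCompactlySupportedVariation a b γ ε G) (hab : a < b) {x : ℝ}
    (hx : x ∈ Icc a b) :
    HasDerivAt (fun t => unitTangent a b (G t) x) (tangentVariation a b ε G x) 0 :=
  hasDerivAt_partialFst (h.contDiffOn_tangent hab) h.zero_mem hx

lemma unitTangent_zero (h : IsCompactlySupportedVariation a b γ ε G) {x : ℝ}
    (hx : x ∈ Icc a b) : unitTangent a b (G 0) x = unitTangent a b γ x :=
  unitTangent_congr h.start hx

lemma D_unitTangent_zero (h : IsCompactlySupportedVariation a b γ ε G) {x : ℝ}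
    (hx : x ∈ Icc a b) : D a b (unitTangent a b (G 0)) x = D a b (unitTangent a b γ) x :=
  D_congr (unitTangent_congr h.start) hx

/-- The time and space derivatives of the unit tangent commute. -/
lemma hasDerivAt_D_tangent (h : IsCompactlySupportedVariation a b γ ε G) (hab : a < b) {x : ℝ}
    (hx : x ∈ Icc a b) :
    HasDerivAt (fun t => D a b (unitTangent a b (G t)) x)
      (D a b (tangentVariation a b ε G) x) 0 := by
  have hT := h.contDiffOn_tangent hab
  have h1 := hasDerivAt_partialFst (contDiffOn_partialSnd h.neg_lt hab hT) h.zero_mem hx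
  rw [partialFst_partialSnd h.neg_lt hab hT ⟨h.zero_mem_Icc, hx⟩,
    partialSnd_eq_D hab (contDiffOn_partialFst h.neg_lt hab hT) h.zero_mem_Icc hx] at h1
  refine h1.congr_of_eventuallyEq ?_
  filter_upwards [Icc_mem_nhds h.zero_mem.1 h.zero_mem.2] with t ht
  exact (partialSnd_eq_D hab hT ht hx).symm

lemma inner_tangentVariation (h : IsCompactlySupportedVariation a b γ ε G) (hab : a < b) {x : ℝ}
    (hx : x ∈ Icc a b) :
    inner ℝ (unitTangent a b γ x) (tangentVariation a b ε G x) = 0 := by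
  have h1 := h.hasDerivAt_tangent hab hx
  have h2 := h1.inner ℝ h1
  have h3 : HasDerivAt (fun t => inner ℝ (unitTangent a b (G t) x) (unitTangent a b (G t) x))
      (0 : ℝ) 0 := by
    refine (hasDerivAt_const (0 : ℝ) (1 : ℝ)).congr_of_eventuallyEq ?_
    filter_upwards [Icc_mem_nhds h.zero_mem.1 h.zero_mem.2] with t ht
    simp [(h.isCurve t ht).norm_unitTangent hx]
  have h4 := h2.unique h3
  rw [h.unitTangent_zero hx, real_inner_comm (unitTangent a b γ x)
    (tangentVariation a b ε G x)] at h4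
  rw [real_inner_comm] at h4 ⊢
  linarith

lemma eventuallyEq_left (h : IsCompactlySupportedVariation a b γ ε G) {t : ℝ}
    (ht : t ∈ Icc (-ε) ε) : G t =ᶠ[𝓝[Icc a b] a] γ := by
  obtain ⟨δ, hδ, hs⟩ := h.support
  filter_upwards [self_mem_nhdsWithin, mem_nhdsWithin_of_mem_nhds
    (Iio_mem_nhds (by linarith : a < a + δ))] with x hx hx'
  exact hs t ht x (Or.inl ⟨hx.1, le_of_lt hx'⟩) hx

lemma eventuallyEq_right (h : IsCompactlySupportedVariation a b γ ε G) {t : ℝ}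
    (ht : t ∈ Icc (-ε) ε) : G t =ᶠ[𝓝[Icc a b] b] γ := by
  obtain ⟨δ, hδ, hs⟩ := h.support
  filter_upwards [self_mem_nhdsWithin, mem_nhdsWithin_of_mem_nhds
    (Ioi_mem_nhds (by linarith : b - δ < b))] with x hx hx'
  exact hs t ht x (Or.inr ⟨le_of_lt hx', hx.2⟩) hx

lemma unitTangent_left (h : IsCompactlySupportedVariation a b γ ε G) (hab : a < b) {t : ℝ}
    (ht : t ∈ Icc (-ε) ε) : unitTangent a b (G t) a = unitTangent a b γ a := by
  have e := h.eventuallyEq_left ht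
  simp only [unitTangent, arcDeriv, D, e.derivWithin_eq_of_mem (left_mem_Icc.2 hab.le)]

lemma unitTangent_right (h : IsCompactlySupportedVariation a b γ ε G) (hab : a < b) {t : ℝ}
    (ht : t ∈ Icc (-ε) ε) : unitTangent a b (G t) b = unitTangent a b γ b := by
  have e := h.eventuallyEq_right ht
  simp only [unitTangent, arcDeriv, D, e.derivWithin_eq_of_mem (right_mem_Icc.2 hab.le)]

lemma tangentVariation_left (h : IsCompactlySupportedVariation a b γ ε G) (hab : a < b) :
    tangentVariation a b ε G a = 0 := by
  refine (h.hasDerivAt_tangent hab (left_mem_Icc.2 hab.le)).unique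
    ((hasDerivAt_const (0 : ℝ) (unitTangent a b γ a)).congr_of_eventuallyEq ?_)
  filter_upwards [Icc_mem_nhds h.zero_mem.1 h.zero_mem.2] with t ht
  exact h.unitTangent_left hab ht

lemma tangentVariation_right (h : IsCompactlySupportedVariation a b γ ε G) (hab : a < b) :
    tangentVariation a b ε G b = 0 := by
  refine (h.hasDerivAt_tangent hab (right_mem_Icc.2 hab.le)).unique
    ((hasDerivAt_const (0 : ℝ) (unitTangent a b γ b)).congr_of_eventuallyEq ?_)
  filter_upwards [Icc_mem_nhds h.zero_mem.1 h.zero_mem.2] with t ht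
  exact h.unitTangent_right hab ht

lemma norm_D_zero (h : IsCompactlySupportedVariation a b γ ε G) (hs : IsArcLengthParam a b γ)
    {x : ℝ} (hx : x ∈ Icc a b) : ‖D a b (G 0) x‖ = 1 := by
  rw [D_congr h.start hx, hs x hx]

/-- If arc-length is constrained, the velocity and the unit tangent have the same variation. -/
lemma hasDerivAt_velocity (h : IsCompactlySupportedVariation a b γ ε G) (hab : a < b)
    (hs : IsArcLengthParam a b γ) (hc : ConstrainsArcLength a b G) {x : ℝ} (hx : x ∈ Icc a b) :
    HasDerivAt (fun t => D a b (G t) x) (tangentVariation a b ε G x) 0 := by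
  have h1 := (hc x hx).smul (h.hasDerivAt_tangent hab hx)
  rw [h.norm_D_zero hs hx] at h1
  simp only [one_smul, zero_smul, add_zero] at h1
  refine h1.congr_of_eventuallyEq ?_
  filter_upwards [Icc_mem_nhds h.zero_mem.1 h.zero_mem.2] with t ht
  exact (norm_smul_unitTangent (G t) x ((h.isCurve t ht).2 x hx)).symm

/-- The integral of the velocity is `γ b - γ a` for all small times. Differentiating it in time
integrates the variation of the velocity, which the arc-length constraint identifies with that of
the tangent. -/
lemma integral_tangentVariation (h : IsCompactlySupportedVariation a b γ ε G) (hab : a < b)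
    (hs : IsArcLengthParam a b γ) (hc : ConstrainsArcLength a b G) :
    ∫ x in a..b, tangentVariation a b ε G x = 0 := by
  have h1 := hasDerivAt_integral_partialFst h.neg_lt hab (h.contDiffOn_velocity hab) h.zero_mem
  have h2 : HasDerivAt (fun t => ∫ x in a..b, D a b (G t) x) 0 0 := by
    refine (hasDerivAt_const (0 : ℝ) (γ b - γ a)).congr_of_eventuallyEq ?_
    filter_upwards [Icc_mem_nhds h.zero_mem.1 h.zero_mem.2] with t ht
    rw [integral_D hab (h.isCurve t ht).1,
      (h.eventuallyEq_left ht).eq_of_nhdsWithin (left_mem_Icc.2 hab.le),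
      (h.eventuallyEq_right ht).eq_of_nhdsWithin (right_mem_Icc.2 hab.le)]
  rw [← h1.unique h2]
  refine intervalIntegral.integral_congr fun x hx => ?_
  rw [uIcc_of_le hab.le] at hx
  exact (h.hasDerivAt_velocity hab hs hc hx).unique
    (hasDerivAt_partialFst (h.contDiffOn_velocity hab) h.zero_mem hx)

/-- The first variation of the bending energy under variations that constrain arc-length. -/
lemma hasDerivAt_bendingEnergy (h : IsCompactlySupportedVariation a b γ ε G) (hab : a < b)
    (hs : IsArcLengthParam a b γ) (hc : ConstrainsArcLength a b G) {ϱ : ℝ → ℝ}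
    (hϱ : SmoothOnIcc a b ϱ) :
    HasDerivAt (fun t => bendingEnergy a b ϱ (G t))
      (∫ x in a..b, ϱ x *
        inner ℝ (D a b (unitTangent a b γ) x) (D a b (tangentVariation a b ε G) x)) 0 := by
  have hT := h.contDiffOn_tangent hab
  have hD : ContDiffOn ℝ ∞ (fun p : ℝ × ℝ => D a b (unitTangent a b (G p.1)) p.2)
      (Icc (-ε) ε ×ˢ Icc a b) :=
    (contDiffOn_partialSnd h.neg_lt hab hT).congr fun _ hp =>
      (partialSnd_eq_D hab hT hp.1 hp.2).symm
  have hS : ContDiffOn ℝ ∞ (fun p : ℝ × ℝ => arcDeriv a b (G p.1) (unitTangent a b (G p.1)) p.2)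
      (Icc (-ε) ε ×ˢ Icc a b) := (h.contDiffOn_inv_speed hab).smul hD
  have hϱ2 : ContDiffOn ℝ ∞ (fun p : ℝ × ℝ => ϱ p.2) (Icc (-ε) ε ×ˢ Icc a b) :=
    ContDiffOn.comp hϱ contDiffOn_snd fun p hp => hp.2
  have hL := (hϱ2.mul (hS.inner ℝ hS)).mul (h.contDiffOn_speed hab)
  have h1 := (hasDerivAt_integral_partialFst h.neg_lt hab hL h.zero_mem).const_mul (1 / 2 : ℝ)
  refine h1.congr_deriv ?_
  rw [← intervalIntegral.integral_const_mul]
  refine intervalIntegral.integral_congr fun x hx => ?_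
  rw [uIcc_of_le hab.le] at hx
  have hn := h.norm_D_zero hs hx
  -- The speed is `1` with vanishing time derivative, so the factors `|γ'|⁻¹` and `|γ'|` do not
  -- contribute.
  have hinv := (hc x hx).inv (by rw [hn]; exact one_ne_zero)
  have hSd := hinv.smul (h.hasDerivAt_D_tangent hab hx)
  have hd := ((((hSd.inner ℝ hSd).const_mul (ϱ x))).mul (hc x hx))
  have := (hasDerivAt_partialFst hL h.zero_mem hx).unique hd
  simp only [this]
  simp only [Pi.smul_apply', Pi.inv_apply, hn, h.D_unitTangent_zero hx]
  simp only [inv_one, one_smul, neg_zero, zero_div, zero_smul, add_zero,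
    real_inner_comm (D a b (unitTangent a b γ) x) (D a b (tangentVariation a b ε G) x)]
  ring

end IsCompactlySupportedVariation
end Variation

/-! ### Smooth antiderivatives. -/

section Antiderivative
variable {F : Type*} [NormedAddCommGroup F] [NormedSpace ℝ F] [CompleteSpace F] {a b : ℝ}

lemma hasDerivWithinAt_integral {f : ℝ → F} (hf : ContinuousOn f (Icc a b)) {x : ℝ}
    (hx : x ∈ Icc a b) :
    HasDerivWithinAt (fun y => ∫ u in a..y, f u) (f x) (Icc a b) x := by
  have : Fact (x ∈ Icc a b) := ⟨hx⟩
  refine intervalIntegral.integral_hasDerivWithinAt_right ?_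
    (hf.stronglyMeasurableAtFilter_nhdsWithin measurableSet_Icc x) (hf x hx)
  refine ContinuousOn.intervalIntegrable (hf.mono ?_)
  rw [uIcc_of_le hx.1]
  exact Icc_subset_Icc_right hx.2

lemma SmoothOnIcc.integral (hab : a < b) {f : ℝ → F} (hf : SmoothOnIcc a b f) :
    SmoothOnIcc a b (fun y => ∫ u in a..y, f u) := by
  refine (contDiffOn_infty_iff_derivWithin (uniqueDiffOn_Icc hab)).2
    ⟨fun x hx => (hasDerivWithinAt_integral hf.continuousOn hx).differentiableWithinAt, ?_⟩
  exact ContDiffOn.congr hf fun x hx => D_eq hab hx (hasDerivWithinAt_integral hf.continuousOn hx)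

end Antiderivative

/-! ### Normal frames, parallel transport and holonomy. -/

section Frames
variable {a b : ℝ}

/-- The rotation of the vector `N` about the axis `T` by the angle `φ`, for `N` normal to `T`. -/
noncomputable def rotate (T N : E3) (φ : ℝ) : E3 := Real.cos φ • N + Real.sin φ • cross T N

lemma exists_eq_rotate {T N W : E3} (hT : ‖T‖ = 1) (hN : ‖N‖ = 1) (hNT : inner ℝ N T = 0)
    (hW : ‖W‖ = 1) (hWT : inner ℝ W T = 0) : ∃ φ : ℝ, W = rotate T N φ := by
  have hTT : inner ℝ T T = (1 : ℝ) := by simp [hT]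
  have hNN : inner ℝ N N = (1 : ℝ) := by simp [hN]
  have hWW : inner ℝ W W = (1 : ℝ) := by simp [hW]
  have hTN : inner ℝ T N = (0 : ℝ) := by rw [real_inner_comm]; exact hNT
  have hBB : inner ℝ (cross T N) (cross T N) = (1 : ℝ) := by
    rw [inner_cross_cross, hTT, hNN, hTN, hNT]; norm_num
  have hNB : inner ℝ N (cross T N) = (0 : ℝ) := by
    rw [real_inner_comm, inner_cross_self_right]
  set p : ℝ := inner ℝ W N with hp
  set q : ℝ := inner ℝ W (cross T N) with hq
  have hdec : W = p • N + q • cross T N := by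
    have : W - (p • N + q • cross T N) = 0 := by
      refine eq_zero_of_inner_frame_eq_zero hT hN hNT ?_ ?_ ?_
      · simp [inner_sub_left, inner_add_left, real_inner_smul_left, hWT, hNT]
      · simp only [inner_sub_left, inner_add_left, real_inner_smul_left, hNN,
          inner_cross_self_right, ← hp]
        ring
      · simp only [inner_sub_left, inner_add_left, real_inner_smul_left, hNB, hBB, ← hq]
        ring
    exact sub_eq_zero.1 this
  have hpq : p ^ 2 + q ^ 2 = 1 := by
    have h1 : inner ℝ W W = p * inner ℝ W N + q * inner ℝ W (cross T N) := by
      rw [← real_inner_smul_right, ← real_inner_smul_right, ← inner_add_right, ← hdec]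
    rw [hWW, ← hp, ← hq] at h1
    linarith
  have hn : ‖(⟨p, q⟩ : ℂ)‖ = 1 := by
    have h2 : ‖(⟨p, q⟩ : ℂ)‖ ^ 2 = 1 := by
      rw [Complex.sq_norm, Complex.normSq_apply]; simp only; linarith
    exact (pow_eq_one_iff_of_nonneg (norm_nonneg _) two_ne_zero).1 h2
  -- The coordinates of `W` in the normal frame form a unit complex number, whose argument is the
  -- angle.
  refine ⟨Complex.arg ⟨p, q⟩, ?_⟩
  have hc := Complex.norm_mul_cos_arg ⟨p, q⟩
  have hsn := Complex.norm_mul_sin_arg ⟨p, q⟩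
  rw [hn, one_mul] at hc hsn
  rw [rotate, hc, hsn]
  exact hdec

lemma rotate_rotate {T N : E3} (hT : ‖T‖ = 1) (hNT : inner ℝ N T = 0) (φ ψ : ℝ) :
    rotate T (rotate T N φ) ψ = rotate T N (φ + ψ) := by
  have hTN : inner ℝ T N = (0 : ℝ) := by rw [real_inner_comm]; exact hNT
  simp only [rotate, cross_add_right, cross_smul_right, cross_cross_right, hTN,
    real_inner_self_eq_norm_sq, hT, Real.cos_add, Real.sin_add]
  module

/-- Rotating a unit normal field by minus the integral of its connection form gives a parallel
normal field. -/
lemma isParallelNormalField_rotate (hab : a < b) {γ N : ℝ → E3} {φ : ℝ → ℝ}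
    (hγ : IsCurve a b γ) (hN : SmoothOnIcc a b N) (hN1 : ∀ x ∈ Icc a b, ‖N x‖ = 1)
    (hNT : ∀ x ∈ Icc a b, inner ℝ (N x) (unitTangent a b γ x) = 0)
    (hφ : SmoothOnIcc a b φ)
    (hφ' : ∀ x ∈ Icc a b, D a b φ x =
      -inner ℝ (D a b N x) (cross (unitTangent a b γ x) (N x))) :
    IsParallelNormalField a b γ (fun x => rotate (unitTangent a b γ x) (N x) (φ x)) := by
  set T := unitTangent a b γ with hTdef
  have hT : SmoothOnIcc a b T := hγ.smoothOnIcc_unitTangent hab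
  have hT1 : ∀ x ∈ Icc a b, ‖T x‖ = 1 := fun x hx => hγ.norm_unitTangent hx
  set Z : ℝ → E3 := fun x => rotate (T x) (N x) (φ x) with hZdef
  have hZ : SmoothOnIcc a b Z :=
    ((Real.contDiff_cos.comp_contDiffOn hφ).smul hN).add
      ((Real.contDiff_sin.comp_contDiffOn hφ).smul (ContDiffOn.cross hT hN))
  refine ⟨hZ, fun x hx => ?_, fun x => inner ℝ (D a b Z x) (T x),
    ContDiffOn.inner ℝ (hZ.derivWithin hab) hT, fun x hx => ?_⟩
  · change inner ℝ (Z x) (T x) = 0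
    simp only [hZdef, rotate, inner_add_left, real_inner_smul_left, hNT x hx,
      inner_cross_self_left]
    ring
  have hTT : inner ℝ (T x) (T x) = (1 : ℝ) := by simp [hT1 x hx]
  have hNN : inner ℝ (N x) (N x) = (1 : ℝ) := by simp [hN1 x hx]
  have hTN : inner ℝ (T x) (N x) = (0 : ℝ) := by rw [real_inner_comm]; exact hNT x hx
  have hBB : inner ℝ (cross (T x) (N x)) (cross (T x) (N x)) = (1 : ℝ) := by
    rw [inner_cross_cross, hTT, hNN, hTN, hNT x hx]; norm_num
  have hNB : inner ℝ (N x) (cross (T x) (N x)) = (0 : ℝ) := by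
    rw [real_inner_comm, inner_cross_self_right]
  have hN'N : inner ℝ (D a b N x) (N x) = (0 : ℝ) := by
    rw [real_inner_comm]; exact inner_D_self_eq_zero hab hN hN1 hx
  have hT'T : inner ℝ (D a b T x) (T x) = (0 : ℝ) := by
    rw [real_inner_comm]; exact inner_D_self_eq_zero hab hT hT1 hx
  have hB'N : inner ℝ (cross (T x) (D a b N x)) (N x) = D a b φ x := by
    rw [hφ' x hx, inner_cross_rotate, inner_cross_swap, inner_cross_swap, neg_neg,
      inner_cross_rotate, inner_cross_swap, real_inner_comm]
  have hDZ := D_eq hab hx (((hφ.hasDerivWithinAt hx).cos.smul (hN.hasDerivWithinAt hx)).add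
    ((hφ.hasDerivWithinAt hx).sin.smul
      ((hT.hasDerivWithinAt hx).cross (hN.hasDerivWithinAt hx))))
  change D a b Z x = _ at hDZ
  -- The components of `Z'` along `N` and `T × N` are `-sin φ` and `cos φ` times `φ' + ⟨N', T × N⟩`,
  -- which vanishes by the choice of `φ`.
  have e : D a b Z x - inner ℝ (D a b Z x) (T x) • T x = 0 := by
    refine eq_zero_of_inner_frame_eq_zero (hT1 x hx) (hN1 x hx) (hNT x hx) ?_ ?_ ?_
    · rw [inner_sub_left, real_inner_smul_left, hTT]; ring
    · rw [inner_sub_left, real_inner_smul_left, hTN, hDZ]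
      simp only [inner_add_left, real_inner_smul_left, hN'N, hNN, inner_cross_self_right, hB'N]
      ring
    · rw [inner_sub_left, real_inner_smul_left, real_inner_comm (cross (T x) (N x)) (T x),
        inner_cross_self_left, hDZ]
      simp only [inner_add_left, real_inner_smul_left, hNB, hBB, inner_cross_cross, hTT, hN'N,
        hTN, hT'T, hNN, hNT x hx]
      rw [hφ' x hx]
      ring
  exact sub_eq_zero.1 e

/-- The holonomy angle is unique. -/
lemma IsHolonomy.unique (hab : a < b) {γ : ℝ → E3} (hγ : IsCurve a b γ) {Wa Wb : E3}
    (hWb : IsUnitNormalAt a b γ b Wb) {θ ψ : Real.Angle} (hθ : IsHolonomy a b γ Wa Wb θ)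
    (hψ : IsHolonomy a b γ Wa Wb ψ) : θ = ψ := by
  obtain ⟨Z, ⟨hZ, hZT, l, -, hl⟩, hZa, hZb⟩ := hθ
  obtain ⟨Y, ⟨hY, hYT, m, -, hm⟩, hYa, hYb⟩ := hψ
  -- The difference of two parallel normal fields is normal with tangential derivative, so its
  -- length is constant; here it starts at zero.
  have hd : ∀ x ∈ Icc a b, HasDerivWithinAt (fun x => inner ℝ (Z x - Y x) (Z x - Y x)) (0 : ℝ)
      (Icc a b) x := by
    intro x hx
    have h := (hZ.hasDerivWithinAt hx).sub (hY.hasDerivWithinAt hx)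
    refine (h.inner ℝ h).congr_deriv ?_
    have h0 : inner ℝ (Z x - Y x) (D a b Z x - D a b Y x) = (0 : ℝ) := by
      rw [hl x hx, hm x hx, ← sub_smul, real_inner_smul_right, inner_sub_left, hZT x hx, hYT x hx]
      ring
    have h0' : inner ℝ (D a b Z x - D a b Y x) (Z x - Y x) = (0 : ℝ) := by
      rw [real_inner_comm]; exact h0
    simp only [Pi.sub_apply, h0, h0', add_zero]
  have hb := eq_left_of_hasDerivWithinAt_zero hd (right_mem_Icc.2 hab.le)
  simp only [hZa, hYa, sub_self, inner_zero_left] at hb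
  have hZY : Z b = Y b := sub_eq_zero.1 (inner_self_eq_zero.1 hb)
  rw [hZb, hYb] at hZY
  have hT1 := hγ.norm_unitTangent (right_mem_Icc.2 hab.le)
  have hWW : inner ℝ Wb Wb = (1 : ℝ) := by simp [hWb.1]
  have hTT : inner ℝ (unitTangent a b γ b) (unitTangent a b γ b) = (1 : ℝ) := by simp [hT1]
  have hc := congrArg (fun u => inner ℝ u Wb) hZY
  have hsn := congrArg (fun u => inner ℝ u (cross (unitTangent a b γ b) Wb)) hZY
  have hWB : inner ℝ Wb (cross (unitTangent a b γ b) Wb) = (0 : ℝ) := by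
    rw [real_inner_comm, inner_cross_self_right]
  simp only [inner_add_left, real_inner_smul_left, hWW, inner_cross_self_right, hWB,
    inner_cross_cross, hTT, hWb.2] at hc hsn
  induction θ using Real.Angle.induction_on with
  | h θ =>
  induction ψ using Real.Angle.induction_on with
  | h ψ =>
  simp only [Real.Angle.cos_coe, Real.Angle.sin_coe] at hc hsn
  exact Real.Angle.cos_sin_inj (by linarith) (by linarith)

/-- The normal field of a unit field `T` that is obtained from a fixed vector `v`. -/
noncomputable def normalOf (v T : E3) : E3 := ‖cross v T‖⁻¹ • cross v T

/-- The connection form of `normalOf v T` as a function of `T` and its derivative. -/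
noncomputable def connectionForm (v T T' : E3) : ℝ :=
  inner ℝ v T * inner ℝ (cross v T) T' / inner ℝ (cross v T) (cross v T)

lemma norm_normalOf {v T : E3} (h : cross v T ≠ 0) : ‖normalOf v T‖ = 1 := by
  rw [normalOf, norm_smul, norm_inv, norm_norm]
  exact inv_mul_cancel₀ (norm_ne_zero_iff.2 h)

lemma inner_normalOf (v T : E3) : inner ℝ (normalOf v T) T = 0 := by
  rw [normalOf, real_inner_smul_left, inner_cross_self_right, mul_zero]

lemma smoothOnIcc_normalOf {v : E3} {T : ℝ → E3} (hT : SmoothOnIcc a b T)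
    (h : ∀ x ∈ Icc a b, cross v (T x) ≠ 0) : SmoothOnIcc a b (fun x => normalOf v (T x)) := by
  have hw : ContDiffOn ℝ ∞ (fun x => cross v (T x)) (Icc a b) := contDiffOn_const.cross hT
  exact ((hw.norm ℝ h).inv fun x hx => norm_ne_zero_iff.2 (h x hx)).smul hw

/-- The derivative of the normalizing factor multiplies `v × T`, which is orthogonal to `T × (v ×
T)`. Only `v × T'` contributes. -/
lemma inner_D_normalOf (hab : a < b) {v : E3} {T : ℝ → E3} (hT : SmoothOnIcc a b T)
    (hT1 : ∀ x ∈ Icc a b, ‖T x‖ = 1) (h : ∀ x ∈ Icc a b, cross v (T x) ≠ 0) {x : ℝ}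
    (hx : x ∈ Icc a b) :
    inner ℝ (D a b (fun x => normalOf v (T x)) x) (cross (T x) (normalOf v (T x))) =
      connectionForm v (T x) (D a b T x) := by
  have hw : SmoothOnIcc a b (fun x => cross v (T x)) := contDiffOn_const.cross hT
  have hr : SmoothOnIcc a b (fun x => ‖cross v (T x)‖⁻¹) :=
    (ContDiffOn.norm ℝ hw h).inv fun x hx => norm_ne_zero_iff.2 (h x hx)
  have hwd : HasDerivWithinAt (fun x => cross v (T x)) (cross v (D a b T x)) (Icc a b) x :=
    ((hasDerivWithinAt_const x (Icc a b) v).cross (hT.hasDerivWithinAt hx)).congr_deriv (by simp)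
  have hd := D_eq hab hx ((hr.hasDerivWithinAt hx).smul hwd)
  change D a b (fun x => normalOf v (T x)) x = _ at hd
  have hTT : inner ℝ (T x) (T x) = (1 : ℝ) := by simp [hT1 x hx]
  have hTT' : inner ℝ (D a b T x) (T x) = (0 : ℝ) := by
    rw [real_inner_comm]; exact inner_D_self_eq_zero hab hT hT1 hx
  have hwT : inner ℝ (cross v (T x)) (cross (T x) (cross v (T x))) = (0 : ℝ) := by
    rw [real_inner_comm, inner_cross_self_right]
  have hrot : inner ℝ (cross v (D a b T x)) (T x) = -inner ℝ (cross v (T x)) (D a b T x) := by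
    rw [inner_cross_rotate, inner_cross_swap, ← inner_cross_rotate]
  have hw' : inner ℝ (cross v (D a b T x)) (cross (T x) (cross v (T x))) =
      inner ℝ v (T x) * inner ℝ (cross v (T x)) (D a b T x) := by
    rw [cross_cross_right, inner_sub_right, real_inner_smul_right, real_inner_smul_right,
      inner_cross_self_left, hrot, real_inner_comm v (T x)]
    ring
  have hne : ‖cross v (T x)‖ ≠ 0 := norm_ne_zero_iff.2 (h x hx)
  rw [hd, normalOf, cross_smul_right, real_inner_smul_right, inner_add_left,
    real_inner_smul_left, real_inner_smul_left, hwT, hw', connectionForm,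
    real_inner_self_eq_norm_sq]
  field_simp
  ring_nf

/-- The holonomy in terms of the integral of the connection form. -/
lemma isHolonomy_connectionForm (hab : a < b) {γ : ℝ → E3} (hγ : IsCurve a b γ) {v : E3}
    (hv : ∀ x ∈ Icc a b, cross v (unitTangent a b γ x) ≠ 0) (φa φb : ℝ) :
    IsHolonomy a b γ (rotate (unitTangent a b γ a) (normalOf v (unitTangent a b γ a)) φa)
      (rotate (unitTangent a b γ b) (normalOf v (unitTangent a b γ b)) φb)
      ((φa - φb - ∫ x in a..b,
        connectionForm v (unitTangent a b γ x) (D a b (unitTangent a b γ) x) : ℝ) :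
          Real.Angle) := by
  set T := unitTangent a b γ with hTdef
  have hT : SmoothOnIcc a b T := hγ.smoothOnIcc_unitTangent hab
  have hT1 : ∀ x ∈ Icc a b, ‖T x‖ = 1 := fun x hx => hγ.norm_unitTangent hx
  have hw : ContDiffOn ℝ ∞ (fun x => cross v (T x)) (Icc a b) := contDiffOn_const.cross hT
  have hα : SmoothOnIcc a b (fun x => connectionForm v (T x) (D a b T x)) :=
    ((contDiffOn_const.inner ℝ hT).mul (hw.inner ℝ (hT.derivWithin hab))).div (hw.inner ℝ hw)
      fun x hx => by simpa using hv x hx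
  have hint := hα.integral hab
  have hφ : SmoothOnIcc a b
      (fun y => φa - ∫ x in a..y, connectionForm v (T x) (D a b T x)) :=
    contDiffOn_const.sub hint
  refine ⟨_, isParallelNormalField_rotate hab hγ (smoothOnIcc_normalOf hT hv)
    (fun x hx => norm_normalOf (hv x hx)) (fun x hx => inner_normalOf _ _) hφ
    (fun x hx => ?_), ?_, ?_⟩
  · rw [inner_D_normalOf hab hT hT1 hv hx]
    exact D_eq hab hx (((hasDerivWithinAt_const x (Icc a b) φa).sub
      (hasDerivWithinAt_integral hα.continuousOn hx)).congr_deriv (by simp))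
  · simp only [intervalIntegral.integral_same, sub_zero]
    rfl
  · rw [Real.Angle.cos_coe, Real.Angle.sin_coe]
    change rotate _ _ _ = rotate _ _ _
    rw [rotate_rotate (hT1 b (right_mem_Icc.2 hab.le)) (inner_normalOf _ _)]
    congr 1
    ring

/-- A smooth curve of vectors does not meet all lines through the origin. -/
lemma exists_forall_cross_ne_zero {T : ℝ → E3} (hT : SmoothOnIcc a b T)
    (hT1 : ∀ x ∈ Icc a b, ‖T x‖ = 1) : ∃ v : E3, ∀ x ∈ Icc a b, cross v (T x) ≠ 0 := by
  -- The lines spanned by the `T x` are swept out by a `C¹` map from a set of dimension at most two.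
  -- Its image in three-space has dense complement, from which `v` is taken.
  have hf : ContDiffOn ℝ 1 (fun p : ℝ × ℝ => p.1 • T p.2) (univ ×ˢ Icc a b) :=
    contDiffOn_fst.smul ((ContDiffOn.of_le hT (by simp)).comp contDiffOn_snd fun p hp => hp.2)
  have hdim : dimH ((univ : Set ℝ) ×ˢ Icc a b) < Module.finrank ℝ E3 := by
    refine (dimH_mono (subset_univ _)).trans_lt ?_
    rw [Real.dimH_univ_eq_finrank]
    norm_num
  obtain ⟨v, hv⟩ := (hf.dense_compl_image_of_dimH_lt_finrank (convex_univ.prod (convex_Icc a b))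
    Subset.rfl hdim).nonempty
  refine ⟨v, fun x hx h0 => hv ⟨(inner ℝ (T x) v, x), ⟨mem_univ _, hx⟩, ?_⟩⟩
  have h1 : cross (T x) (cross v (T x)) = 0 := by rw [h0, cross_zero_right]
  rw [cross_cross_right, real_inner_self_eq_norm_sq, hT1 x hx] at h1
  simpa using (sub_eq_zero.1 h1).symm

end Frames

/-- Both vectors are tangent to the unit sphere at `T`, so their cross product points along `T`; the
coefficient is the area form. -/
lemma cross_variations_eq {T y p : E3} (hT : ‖T‖ = 1) (hy : inner ℝ T y = 0)
    (hp : inner ℝ T p = 0) : cross y p = inner ℝ (cross T y) p • T := by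
  refine eq_of_cross_eq_of_inner_eq hT ?_ ?_
  · rw [cross_cross_right, hy, hp]; simp [cross_smul_right]
  · rw [real_inner_smul_right, real_inner_self_eq_norm_sq, hT, inner_cross_rotate,
      real_inner_comm]
    ring

/-- The curvature of the connection of the normal bundle of the unit sphere. -/
lemma connectionForm_curvature {v T y p : E3} (hT : ‖T‖ = 1) (hy : inner ℝ T y = 0)
    (hp : inner ℝ T p = 0) :
    (inner ℝ v y * inner ℝ (cross v T) p - inner ℝ v p * inner ℝ (cross v T) y
        + 2 * inner ℝ v T * inner ℝ (cross v y) p) * inner ℝ (cross v T) (cross v T)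
      - 2 * inner ℝ v T * (inner ℝ (cross v T) p * inner ℝ (cross v T) (cross v y)
        - inner ℝ (cross v T) y * inner ℝ (cross v T) (cross v p)) =
      -inner ℝ (cross T y) p * (inner ℝ (cross v T) (cross v T) : ℝ) ^ 2 := by
  have hk := cross_variations_eq hT hy hp
  set k : ℝ := inner ℝ (cross T y) p
  have hB : inner ℝ (cross v y) p = k * inner ℝ v T := by
    rw [inner_cross_rotate, hk, real_inner_smul_left, real_inner_comm]
  have hA : inner ℝ v y * inner ℝ (cross v T) p - inner ℝ v p * inner ℝ (cross v T) y =
      -k * inner ℝ (cross v T) (cross v T) := by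
    have h1 := cross_cross_right v y p
    rw [hk, cross_smul_right] at h1
    have h2 := congrArg (fun u => inner ℝ (cross v T) u) h1
    simp only [inner_sub_right, real_inner_smul_right] at h2
    linarith
  have hC : ∀ z : E3, inner ℝ T z = (0 : ℝ) →
      inner ℝ (cross v T) (cross v z) = -(inner ℝ v T * inner ℝ v z : ℝ) := by
    intro z hz
    rw [inner_cross_cross, hz, real_inner_comm v T]
    ring
  rw [hC y hy, hC p hp, hB]
  linear_combination (inner ℝ (cross v T) (cross v T) + 2 * (inner ℝ v T) ^ 2 : ℝ) * hA

/-! ### First variation of the holonomy. -/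

section Variation
variable {a b ε : ℝ} {γ : ℝ → E3} {G : ℝ → ℝ → E3}

namespace IsCompactlySupportedVariation

lemma mono (h : IsCompactlySupportedVariation a b γ ε G) {ε' : ℝ} (h0 : 0 < ε') (hε : ε' ≤ ε) :
    IsCompactlySupportedVariation a b γ ε' G := by
  have hsub : Icc (-ε') ε' ⊆ Icc (-ε) ε := Icc_subset_Icc (by linarith) hε
  obtain ⟨δ, hδ, hs⟩ := h.support
  exact ⟨h0, h.smooth.mono (prod_mono hsub Subset.rfl), fun t ht => h.isCurve t (hsub ht),
    h.start, δ, hδ, fun t ht => hs t (hsub ht)⟩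

/-- Compactness of `[a,b]` makes one vector `v` serve all curves of the variation for small times,
so that their holonomies are read off from the same family of frames. -/
lemma exists_forall_cross_ne_zero (h : IsCompactlySupportedVariation a b γ ε G) (hab : a < b)
    {v : E3} (hv : ∀ x ∈ Icc a b, cross v (unitTangent a b γ x) ≠ 0) :
    ∃ ε', 0 < ε' ∧ ε' ≤ ε ∧ ∀ t ∈ Icc (-ε') ε', ∀ x ∈ Icc a b,
      cross v (unitTangent a b (G t) x) ≠ 0 := by
  have hc : ContinuousOn (fun p : ℝ × ℝ => cross v (unitTangent a b (G p.1) p.2))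
      (Icc (-ε) ε ×ˢ Icc a b) := continuousOn_const.cross (h.contDiffOn_tangent hab).continuousOn
  have key : ∀ᶠ t in 𝓝 (0 : ℝ), ∀ x ∈ Icc a b, (t, x) ∈ Icc (-ε) ε ×ˢ Icc a b →
      cross v (unitTangent a b (G t) x) ≠ 0 := by
    refine isCompact_Icc.eventually_forall_of_forall_eventually fun x hx => ?_
    have hx0 : ((0 : ℝ), x) ∈ Icc (-ε) ε ×ˢ Icc a b := ⟨h.zero_mem_Icc, hx⟩
    have := (hc _ hx0).eventually_ne (b₂ := 0) (by
      simp only [h.unitTangent_zero hx]; exact hv x hx)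
    exact eventually_nhdsWithin_iff.1 this
  obtain ⟨r, hr, hball⟩ := Metric.eventually_nhds_iff.1 key
  refine ⟨min ε (r / 2), lt_min h.pos (by linarith), min_le_left _ _, fun t ht x hx => ?_⟩
  have h1 : min ε (r / 2) ≤ ε := min_le_left _ _
  have h2 : min ε (r / 2) ≤ r / 2 := min_le_right _ _
  refine hball ?_ x hx ⟨⟨by linarith [ht.1], by linarith [ht.2]⟩, hx⟩
  rw [Real.dist_eq, sub_zero, abs_lt]
  exact ⟨by linarith [ht.1], by linarith [ht.2]⟩

/-- The first variation of the integrated connection form. -/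
lemma hasDerivAt_integral_connectionForm (h : IsCompactlySupportedVariation a b γ ε G)
    (hab : a < b) {v : E3} (hv : ∀ t ∈ Icc (-ε) ε, ∀ x ∈ Icc a b,
      cross v (unitTangent a b (G t) x) ≠ 0) :
    HasDerivAt (fun t => ∫ x in a..b, connectionForm v (unitTangent a b (G t) x)
        (D a b (unitTangent a b (G t)) x))
      (-∫ x in a..b, inner ℝ (cross (unitTangent a b γ x) (tangentVariation a b ε G x))
        (D a b (unitTangent a b γ) x)) 0 := by
  have hT := h.contDiffOn_tangent hab
  have hD : ContDiffOn ℝ ∞ (fun p : ℝ × ℝ => D a b (unitTangent a b (G p.1)) p.2)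
      (Icc (-ε) ε ×ˢ Icc a b) :=
    (contDiffOn_partialSnd h.neg_lt hab hT).congr fun _ hp =>
      (partialSnd_eq_D hab hT hp.1 hp.2).symm
  have hw : ContDiffOn ℝ ∞ (fun p : ℝ × ℝ => cross v (unitTangent a b (G p.1) p.2))
      (Icc (-ε) ε ×ˢ Icc a b) := contDiffOn_const.cross hT
  have hα : ContDiffOn ℝ ∞ (fun p : ℝ × ℝ => connectionForm v (unitTangent a b (G p.1) p.2)
      (D a b (unitTangent a b (G p.1)) p.2)) (Icc (-ε) ε ×ˢ Icc a b) :=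
    ((contDiffOn_const.inner ℝ hT).mul (hw.inner ℝ hD)).div (hw.inner ℝ hw)
      fun p hp => by simpa using hv p.1 hp.1 p.2 hp.2
  refine (hasDerivAt_integral_partialFst h.neg_lt hab hα h.zero_mem).congr_deriv ?_
  have hγ : IsCurve a b (G 0) := h.isCurve 0 h.zero_mem_Icc
  have hTγ : SmoothOnIcc a b (unitTangent a b γ) := by
    refine (hγ.smoothOnIcc_unitTangent hab).congr fun x hx => ?_
    exact (h.unitTangent_zero hx).symm
  have hT1 : ∀ x ∈ Icc a b, ‖unitTangent a b γ x‖ = 1 := fun x hx => by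
    rw [← h.unitTangent_zero hx]; exact hγ.norm_unitTangent hx
  have hy := h.smoothOnIcc_tangentVariation hab
  have hT0 : ∀ x ∈ Icc a b, unitTangent a b (G 0) x = unitTangent a b γ x :=
    fun x hx => h.unitTangent_zero hx
  have hD0 : ∀ x ∈ Icc a b, D a b (unitTangent a b (G 0)) x = D a b (unitTangent a b γ) x :=
    fun x hx => h.D_unitTangent_zero hx
  have hya := h.tangentVariation_left hab
  have hyb := h.tangentVariation_right hab
  have hTy : ∀ x ∈ Icc a b, inner ℝ (unitTangent a b γ x) (tangentVariation a b ε G x) = (0 : ℝ) :=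
    fun x hx => h.inner_tangentVariation hab hx
  have hyd : ∀ x ∈ Icc a b, HasDerivAt (fun t => unitTangent a b (G t) x)
      (tangentVariation a b ε G x) 0 := fun x hx => h.hasDerivAt_tangent hab hx
  have hDyd : ∀ x ∈ Icc a b, HasDerivAt (fun t => D a b (unitTangent a b (G t)) x)
      (D a b (tangentVariation a b ε G) x) 0 := fun x hx => h.hasDerivAt_D_tangent hab hx
  set T := unitTangent a b γ
  set y := tangentVariation a b ε G
  have hv0 : ∀ x ∈ Icc a b, cross v (T x) ≠ 0 := fun x hx => by
    rw [← hT0 x hx]; exact hv 0 h.zero_mem_Icc x hx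
  have hwγ : ContDiffOn ℝ ∞ (fun x => cross v (T x)) (Icc a b) := contDiffOn_const.cross hTγ
  have hβ : SmoothOnIcc a b (fun x => connectionForm v (T x) (y x)) :=
    ((contDiffOn_const.inner ℝ hTγ).mul (hwγ.inner ℝ hy)).div (hwγ.inner ℝ hwγ)
      fun x hx => by simpa using hv0 x hx
  have hκ : ContinuousOn (fun x => inner ℝ (cross (T x) (y x)) (D a b T x)) (Icc a b) :=
    (hTγ.continuousOn.cross hy.continuousOn).inner (hTγ.derivWithin hab).continuousOn
  -- Cartan's formula for the connection form: its time derivative is the space derivative of its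
  -- value on `y`, plus its exterior derivative on `(y, T')`, which is minus the area form. The
  -- total derivative integrates to zero because `y` vanishes at the ends.
  have hpt : ∀ x ∈ Icc a b, partialFst (-ε) ε a b (fun p : ℝ × ℝ =>
      connectionForm v (unitTangent a b (G p.1) p.2) (D a b (unitTangent a b (G p.1)) p.2))
      (0, x) = D a b (fun x => connectionForm v (T x) (y x)) x
        - inner ℝ (cross (T x) (y x)) (D a b T x) := by
    intro x hx
    have hne : (inner ℝ (cross v (T x)) (cross v (T x)) : ℝ) ≠ 0 := by simpa using hv0 x hx
    have hTd := hyd x hx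
    have hwd : HasDerivAt (fun t => cross v (unitTangent a b (G t) x)) (cross v (y x)) 0 :=
      ((hasDerivAt_const (0 : ℝ) v).cross hTd).congr_deriv (by simp)
    have ht := ((((hasDerivAt_const (0 : ℝ) v).inner ℝ hTd).mul
      (hwd.inner ℝ (hDyd x hx))).div (hwd.inner ℝ hwd)
      (by rw [hT0 x hx]; exact hne))
    have hxd : HasDerivWithinAt (fun x => cross v (T x)) (cross v (D a b T x)) (Icc a b) x :=
      ((hasDerivWithinAt_const x (Icc a b) v).cross (hTγ.hasDerivWithinAt hx)).congr_deriv
        (by simp)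
    have hs : HasDerivWithinAt (fun x => connectionForm v (T x) (y x)) _ (Icc a b) x := ((((hasDerivWithinAt_const x (Icc a b) v).inner ℝ
      (hTγ.hasDerivWithinAt hx)).mul (hxd.inner ℝ (hy.hasDerivWithinAt hx))).div
      (hxd.inner ℝ hxd) hne)
    rw [(hasDerivAt_partialFst hα h.zero_mem hx).unique ht]
    rw [D_eq hab hx hs]
    simp only [hT0 x hx, hD0 x hx, Pi.mul_apply, inner_zero_left,
      add_zero]
    have hc := connectionForm_curvature (v := v) (hT1 x hx) (hTy x hx)
      (inner_D_self_eq_zero hab hTγ hT1 hx)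
    have hsw : inner ℝ (cross v (D a b T x)) (y x) = -(inner ℝ (cross v (y x)) (D a b T x) : ℝ) := by
      rw [inner_cross_rotate, inner_cross_swap, ← inner_cross_rotate]
    have hcomm : ∀ z : E3, inner ℝ (cross v z) (cross v (T x)) =
        (inner ℝ (cross v (T x)) (cross v z) : ℝ) := fun z => real_inner_comm _ _
    rw [hcomm (y x), hcomm (D a b T x), hsw]
    field_simp
    linear_combination hc
  rw [intervalIntegral.integral_congr (g := fun x =>
    D a b (fun x => connectionForm v (T x) (y x)) x
        - inner ℝ (cross (T x) (y x)) (D a b T x))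
    (fun x hx => by rw [uIcc_of_le hab.le] at hx; exact hpt x hx),
    intervalIntegral.integral_sub, integral_D hab hβ, hya, hyb]
  · simp [connectionForm]
  · refine ContinuousOn.intervalIntegrable ?_
    rw [uIcc_of_le hab.le]
    exact (hβ.derivWithin hab).continuousOn
  · refine ContinuousOn.intervalIntegrable ?_
    rw [uIcc_of_le hab.le]
    exact hκ

lemma tangentVariation_mono (h : IsCompactlySupportedVariation a b γ ε G) (hab : a < b) {ε' : ℝ}
    (h0 : 0 < ε') (hε : ε' ≤ ε) {x : ℝ} (hx : x ∈ Icc a b) :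
    tangentVariation a b ε' G x = tangentVariation a b ε G x :=
  ((h.mono h0 hε).hasDerivAt_tangent hab hx).unique (h.hasDerivAt_tangent hab hx)

/-- The holonomy has a differentiable lift along each variation. -/
lemma exists_holonomy_lift (h : IsCompactlySupportedVariation a b γ ε G) (hab : a < b)
    (hγ : IsCurve a b γ) {Wa Wb : E3} (hWa : IsUnitNormalAt a b γ a Wa)
    (hWb : IsUnitNormalAt a b γ b Wb) :
    ∃ θ : ℝ → ℝ, (∀ᶠ t in 𝓝 (0 : ℝ), IsHolonomy a b (G t) Wa Wb (θ t : Real.Angle)) ∧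
      HasDerivAt θ (∫ x in a..b, inner ℝ
        (cross (unitTangent a b γ x) (tangentVariation a b ε G x))
        (D a b (unitTangent a b γ) x)) 0 := by
  obtain ⟨v, hv⟩ := ElasticCurve.exists_forall_cross_ne_zero (hγ.smoothOnIcc_unitTangent hab)
    (fun x hx => hγ.norm_unitTangent hx)
  obtain ⟨ε', h0, hε, hv'⟩ := h.exists_forall_cross_ne_zero hab hv
  have h' := h.mono h0 hε
  have ha := left_mem_Icc.2 hab.le
  have hb := right_mem_Icc.2 hab.le
  obtain ⟨φa, hφa⟩ := exists_eq_rotate (hγ.norm_unitTangent ha) (norm_normalOf (hv a ha))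
    (inner_normalOf _ _) hWa.1 hWa.2
  obtain ⟨φb, hφb⟩ := exists_eq_rotate (hγ.norm_unitTangent hb) (norm_normalOf (hv b hb))
    (inner_normalOf _ _) hWb.1 hWb.2
  refine ⟨fun t => φa - φb - ∫ x in a..b, connectionForm v (unitTangent a b (G t) x)
        (D a b (unitTangent a b (G t)) x), ?_, ?_⟩
  · filter_upwards [Icc_mem_nhds h'.zero_mem.1 h'.zero_mem.2] with t ht
    have := isHolonomy_connectionForm hab (h'.isCurve t ht) (hv' t ht) φa φb
    rwa [h'.unitTangent_left hab ht, h'.unitTangent_right hab ht, ← hφa, ← hφb] at this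
  · refine ((h'.hasDerivAt_integral_connectionForm hab hv').const_sub (φa - φb)).congr_deriv ?_
    rw [neg_neg]
    refine intervalIntegral.integral_congr fun x hx => ?_
    rw [uIcc_of_le hab.le] at hx
    simp only [h.tangentVariation_mono hab h0 hε hx]

end IsCompactlySupportedVariation

/-- Two lifts of one angle differ by integer multiples of `2π`. Their difference is continuous at
`0`, hence constant near `0`. -/
lemma deriv_eq_of_eventually_angle_eq {θ ψ : ℝ → ℝ} {p q : ℝ}
    (h : ∀ᶠ t in 𝓝 (0 : ℝ), (θ t : Real.Angle) = ψ t) (hθ : HasDerivAt θ p 0)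
    (hψ : HasDerivAt ψ q 0) : p = q := by
  have hd := hθ.sub hψ
  have hc : HasDerivAt (θ - ψ) 0 0 := by
    refine (hasDerivAt_const (0 : ℝ) ((θ - ψ) 0)).congr_of_eventuallyEq ?_
    have hnear : ∀ᶠ t in 𝓝 (0 : ℝ), |(θ - ψ) t - (θ - ψ) 0| < 2 * Real.pi := by
      have := Metric.tendsto_nhds.1 hd.continuousAt (2 * Real.pi) (by positivity)
      simpa only [Real.dist_eq] using this
    filter_upwards [h, hnear] with t ht hlt
    obtain ⟨k, hk⟩ := Real.Angle.angle_eq_iff_two_pi_dvd_sub.1 ht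
    obtain ⟨m, hm⟩ := Real.Angle.angle_eq_iff_two_pi_dvd_sub.1 h.self_of_nhds
    have e : (θ - ψ) t - (θ - ψ) 0 = 2 * Real.pi * ((k - m : ℤ) : ℝ) := by
      simp only [Pi.sub_apply, hk, hm]; push_cast; ring
    rw [e, abs_mul, abs_of_pos (by positivity : (0 : ℝ) < 2 * Real.pi)] at hlt
    have hlt' : |((k - m : ℤ) : ℝ)| < 1 := by
      by_contra hcon
      have : 2 * Real.pi * 1 ≤ 2 * Real.pi * |((k - m : ℤ) : ℝ)| :=
        mul_le_mul_of_nonneg_left (not_lt.1 hcon) (by positivity)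
      linarith
    have h0 : k - m = 0 := by
      rw [← Int.abs_lt_one_iff]
      exact_mod_cast hlt'
    rw [h0] at e
    simp only [Int.cast_zero, mul_zero] at e
    exact sub_eq_zero.1 e
  exact sub_eq_zero.1 (hd.unique hc)

lemma IsCompactlySupportedVariation.constrainsHolonomy_iff
    (h : IsCompactlySupportedVariation a b γ ε G) (hab : a < b) (hγ : IsCurve a b γ) :
    ConstrainsHolonomy a b G ↔ ∫ x in a..b, inner ℝ
        (cross (unitTangent a b γ x) (tangentVariation a b ε G x))
        (D a b (unitTangent a b γ) x) = (0 : ℝ) := by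
  have ha := left_mem_Icc.2 hab.le
  have hb := right_mem_Icc.2 hab.le
  have hn : ∀ x ∈ Icc a b, ∀ W, IsUnitNormalAt a b (G 0) x W ↔ IsUnitNormalAt a b γ x W :=
    fun x hx W => by rw [IsUnitNormalAt, IsUnitNormalAt, h.unitTangent_zero hx]
  constructor
  · intro hc
    -- One pair of unit normals suffices, as the derivative of the holonomy does not depend on the
    -- pair.
    obtain ⟨v, hv⟩ := ElasticCurve.exists_forall_cross_ne_zero (hγ.smoothOnIcc_unitTangent hab)
      (fun x hx => hγ.norm_unitTangent hx)
    have hW : ∀ x ∈ Icc a b, IsUnitNormalAt a b γ x (normalOf v (unitTangent a b γ x)) :=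
      fun x hx => ⟨norm_normalOf (hv x hx), inner_normalOf _ _⟩
    obtain ⟨θ, hθ, hθd⟩ := hc _ _ ((hn a ha _).2 (hW a ha)) ((hn b hb _).2 (hW b hb))
    obtain ⟨ψ, hψ, hψd⟩ := h.exists_holonomy_lift hab hγ (hW a ha) (hW b hb)
    refine deriv_eq_of_eventually_angle_eq ?_ hψd hθd
    filter_upwards [hθ, hψ, Icc_mem_nhds h.zero_mem.1 h.zero_mem.2] with t h1 h2 ht
    refine h2.unique hab (h.isCurve t ht) ?_ h1
    rw [IsUnitNormalAt, h.unitTangent_right hab ht]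
    exact hW b hb
  · intro h0 Wa Wb hWa hWb
    have := h.exists_holonomy_lift hab hγ ((hn a ha _).1 hWa) ((hn b hb _).1 hWb)
    rwa [h0] at this

end Variation

/-! ### Integration by parts. -/

section
variable {a b : ℝ}

lemma SmoothOnIcc.inner {f g : ℝ → E3} (hf : SmoothOnIcc a b f) (hg : SmoothOnIcc a b g) :
    SmoothOnIcc a b (fun x => inner ℝ (f x) (g x)) :=
  ContDiffOn.inner ℝ hf hg

lemma SmoothOnIcc.intervalIntegrable {F : Type*} [NormedAddCommGroup F] [NormedSpace ℝ F]
    (hab : a < b) {f : ℝ → F} (hf : SmoothOnIcc a b f) :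
    IntervalIntegrable f MeasureTheory.volume a b := by
  refine ContinuousOn.intervalIntegrable ?_
  rw [uIcc_of_le hab.le]
  exact hf.continuousOn

lemma integral_congr_Icc {F : Type*} [NormedAddCommGroup F] [NormedSpace ℝ F]
    (hab : a < b) {f g : ℝ → F} (h : ∀ x ∈ Icc a b, f x = g x) :
    ∫ x in a..b, f x = ∫ x in a..b, g x := by
  refine intervalIntegral.integral_congr fun x hx => ?_
  rw [uIcc_of_le hab.le] at hx
  exact h x hx

lemma integral_inner_D (hab : a < b) {u y : ℝ → E3} (hu : SmoothOnIcc a b u)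
    (hy : SmoothOnIcc a b y) (ha : y a = 0) (hb : y b = 0) :
    ∫ x in a..b, inner ℝ (u x) (D a b y x) = -∫ x in a..b, (inner ℝ (D a b u x) (y x) : ℝ) := by
  have h := integral_D hab (hu.inner hy)
  simp only [ha, hb, inner_zero_right, sub_self] at h
  rw [integral_congr_Icc hab (fun x hx => D_eq hab hx
    ((hu.hasDerivWithinAt hx).inner ℝ (hy.hasDerivWithinAt hx))),
    intervalIntegral.integral_add ((hu.inner (hy.derivWithin hab)).intervalIntegrable hab)
      (((hu.derivWithin hab).inner hy).intervalIntegrable hab)] at h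
  linarith

lemma inner_integral (hab : a < b) {y : ℝ → E3} (hy : SmoothOnIcc a b y) (e : E3) :
    ∫ x in a..b, inner ℝ e (y x) = (inner ℝ e (∫ x in a..b, y x) : ℝ) :=
  ContinuousLinearMap.intervalIntegral_comp_comm (innerSL ℝ e) (hy.intervalIntegrable hab)

/-- The first variation of the bending energy after an integration by parts. -/
lemma integral_bending (hab : a < b) {T y : ℝ → E3} {ϱ : ℝ → ℝ} (hT : SmoothOnIcc a b T)
    (hϱ : SmoothOnIcc a b ϱ) (hy : SmoothOnIcc a b y) (ha : y a = 0) (hb : y b = 0) :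
    ∫ x in a..b, ϱ x * inner ℝ (D a b T x) (D a b y x) =
      -∫ x in a..b, (inner ℝ (ϱ x • D a b (D a b T) x + D a b ϱ x • D a b T x) (y x) : ℝ) := by
  have hu : SmoothOnIcc a b (fun x => ϱ x • D a b T x) :=
    ContDiffOn.smul hϱ (hT.derivWithin hab)
  have h := integral_inner_D hab hu hy ha hb
  simp only [real_inner_smul_left] at h
  rw [h]
  congr 1
  refine integral_congr_Icc hab fun x hx => ?_
  have hd : D a b (fun x => ϱ x • D a b T x) x = _ :=
    D_eq hab hx ((hϱ.hasDerivWithinAt hx).smul ((hT.derivWithin hab).hasDerivWithinAt hx))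
  rw [hd]

end

/-! ### The Euler-Lagrange equation implies criticality. -/

section Sufficiency
variable {a b : ℝ} {γ : ℝ → E3} {ϱ : ℝ → ℝ}

theorem isHolonomyConstrainedElastic_of_normal_part (hab : a < b) (hϱ : SmoothOnIcc a b ϱ)
    (hγ : IsCurve a b γ) (hs : IsArcLengthParam a b γ) {T : ℝ → E3}
    (hT : T = unitTangent a b γ) {μ : ℝ} {α : E3}
    (h : ∀ x ∈ Icc a b,
        ϱ x • D a b (D a b T) x
          - (ϱ x * inner ℝ (D a b (D a b T) x) (T x)) • T x
          + D a b ϱ x • D a b T x + α - inner ℝ α (T x) • T x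
          - μ • cross (T x) (D a b T x) = 0) :
    IsHolonomyConstrainedElastic a b ϱ γ := by
  intro ε G hG hc hh
  have hTs : SmoothOnIcc a b T := hT ▸ hγ.smoothOnIcc_unitTangent hab
  have hd := hG.hasDerivAt_bendingEnergy hab hs hc hϱ
  have hhol := (hG.constrainsHolonomy_iff hab hγ).1 hh
  have hint := hG.integral_tangentVariation hab hs hc
  have hy := hG.smoothOnIcc_tangentVariation hab
  have hTy : ∀ x ∈ Icc a b, inner ℝ (T x) (tangentVariation a b ε G x) = (0 : ℝ) :=
    fun x hx => hT ▸ hG.inner_tangentVariation hab hx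
  rw [← hT] at hd hhol
  rw [integral_bending hab hTs hϱ hy (hG.tangentVariation_left hab)
    (hG.tangentVariation_right hab)] at hd
  refine hd.congr_deriv ?_
  set y := tangentVariation a b ε G
  -- Pairing the equation with the normal field `y` removes the multiples of `T`. What remains are
  -- the integrands of the closing condition `∫ y = 0` and of the holonomy constraint.
  have hpt : ∀ x ∈ Icc a b,
      inner ℝ (ϱ x • D a b (D a b T) x + D a b ϱ x • D a b T x) (y x) =
      -inner ℝ α (y x) - μ * inner ℝ (cross (T x) (y x)) (D a b T x) := by
    intro x hx
    have hx0 := congrArg (fun u => inner ℝ u (y x)) (h x hx)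
    simp only [inner_add_left, inner_sub_left, real_inner_smul_left, hTy x hx,
      inner_zero_left] at hx0
    simp only [inner_add_left, real_inner_smul_left]
    have e : inner ℝ (cross (T x) (D a b T x)) (y x) =
        -(inner ℝ (cross (T x) (y x)) (D a b T x) : ℝ) := by
      rw [inner_cross_rotate, inner_cross_swap, inner_cross_rotate, inner_cross_rotate]
    rw [e] at hx0
    linarith
  have hi1 : SmoothOnIcc a b (fun x => -inner ℝ α (y x)) :=
    ContDiffOn.neg (ContDiffOn.inner ℝ contDiffOn_const hy)
  have hi2 : SmoothOnIcc a b (fun x => μ * inner ℝ (cross (T x) (y x)) (D a b T x)) :=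
    contDiffOn_const.mul (SmoothOnIcc.inner (ContDiffOn.cross hTs hy) (hTs.derivWithin hab))
  rw [integral_congr_Icc hab hpt, intervalIntegral.integral_sub (hi1.intervalIntegrable hab)
    (hi2.intervalIntegrable hab), intervalIntegral.integral_neg,
    intervalIntegral.integral_const_mul, hhol, inner_integral hab hy, hint]
  simp

end Sufficiency

/-! ### Criticality implies the Euler-Lagrange equation. -/

section Necessity
variable {a b : ℝ} {γ : ℝ → E3} {ϱ : ℝ → ℝ}

/-- The smooth fields along a curve with unit tangent field `T` that are normal to the curve and
vanish near the end points. -/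
noncomputable def testFields (a b : ℝ) (T : ℝ → E3) : Submodule ℝ (ℝ → E3) where
  carrier := {y | SmoothOnIcc a b y ∧ (∀ x ∈ Icc a b, inner ℝ (T x) (y x) = (0 : ℝ)) ∧
    (∀ᶠ x in 𝓝 a, y x = 0) ∧ ∀ᶠ x in 𝓝 b, y x = 0}
  add_mem' := by
    rintro y z ⟨hy, hyT, hya, hyb⟩ ⟨hz, hzT, hza, hzb⟩
    refine ⟨ContDiffOn.add hy hz, fun x hx => ?_, ?_, ?_⟩
    · rw [Pi.add_apply, inner_add_right, hyT x hx, hzT x hx, add_zero]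
    · filter_upwards [hya, hza] with x h1 h2
      rw [Pi.add_apply, h1, h2, add_zero]
    · filter_upwards [hyb, hzb] with x h1 h2
      rw [Pi.add_apply, h1, h2, add_zero]
  zero_mem' := ⟨contDiffOn_const, by simp, by simp, by simp⟩
  smul_mem' := by
    rintro c y ⟨hy, hyT, hya, hyb⟩
    refine ⟨ContDiffOn.const_smul c hy, fun x hx => ?_, ?_, ?_⟩
    · rw [Pi.smul_apply, real_inner_smul_right, hyT x hx, mul_zero]
    · filter_upwards [hya] with x h1
      rw [Pi.smul_apply, h1, smul_zero]
    · filter_upwards [hyb] with x h1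
      rw [Pi.smul_apply, h1, smul_zero]

/-- The variation in the direction of the antiderivative of a test field. -/
lemma isCompactlySupportedVariation_of_testField (hab : a < b) (hγ : IsCurve a b γ)
    (hs : IsArcLengthParam a b γ) {y : ℝ → E3} (hy : y ∈ testFields a b (unitTangent a b γ))
    (hint : ∫ x in a..b, y x = 0) :
    IsCompactlySupportedVariation a b γ 1 (fun t x => γ x + t • ∫ u in a..x, y u) ∧
      ∀ t : ℝ, ∀ x ∈ Icc a b, D a b (fun x => γ x + t • ∫ u in a..x, y u) x =
        D a b γ x + t • y x := by
  obtain ⟨hys, hyT, hya, hyb⟩ := hy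
  have hD : ∀ t : ℝ, ∀ x ∈ Icc a b, D a b (fun x => γ x + t • ∫ u in a..x, y u) x =
        D a b γ x + t • y x := fun t x hx =>
    D_eq hab hx ((hγ.1.hasDerivWithinAt hx).add
      ((hasDerivWithinAt_integral hys.continuousOn hx).const_smul t))
  have hY := hys.integral hab
  refine ⟨⟨one_pos, ?_, fun t _ => ⟨?_, fun x hx h0 => ?_⟩, fun x _ => by simp, ?_⟩, hD⟩
  · exact (ContDiffOn.comp hγ.1 contDiffOn_snd fun p hp => hp.2).add
      (contDiffOn_fst.smul (ContDiffOn.comp (g := fun z => ∫ u in a..z, y u) hY contDiffOn_snd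
        fun p hp => hp.2))
  · exact ContDiffOn.add hγ.1 (ContDiffOn.const_smul t hY)
  · rw [hD t x hx, ← unitTangent_eq_D hs hx] at h0
    have h1 := congrArg (fun u => inner ℝ (unitTangent a b γ x) u) h0
    simp only [inner_add_right, real_inner_smul_right, hyT x hx, real_inner_self_eq_norm_sq,
      hγ.norm_unitTangent hx, inner_zero_right] at h1
    norm_num at h1
  · obtain ⟨r, hr, hra⟩ := Metric.eventually_nhds_iff.1 hya
    obtain ⟨q, hq, hqb⟩ := Metric.eventually_nhds_iff.1 hyb
    have h1 : min (r / 2) (q / 2) ≤ r / 2 := min_le_left _ _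
    have h2 : min (r / 2) (q / 2) ≤ q / 2 := min_le_right _ _
    refine ⟨min (r / 2) (q / 2), lt_min (by linarith) (by linarith), fun t _ x hx hxab => ?_⟩
    suffices h : ∫ u in a..x, y u = 0 by simp [h]
    rcases hx with hx | hx
    · rw [intervalIntegral.integral_congr (g := fun _ => (0 : E3)), intervalIntegral.integral_zero]
      intro u hu
      rw [uIcc_of_le hxab.1] at hu
      refine hra ?_
      rw [Real.dist_eq, abs_lt]
      exact ⟨by linarith [hu.1], by linarith [hu.2, hx.2]⟩
    · have hi : ∀ c d, a ≤ c → c ≤ d → d ≤ b →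
          IntervalIntegrable y MeasureTheory.volume c d := fun c d hc hcd hd => by
        refine ContinuousOn.intervalIntegrable ?_
        rw [uIcc_of_le hcd]
        exact hys.continuousOn.mono (Icc_subset_Icc hc hd)
      have hadd := intervalIntegral.integral_add_adjacent_intervals
        (hi a x le_rfl hxab.1 hxab.2) (hi x b hxab.1 hxab.2 le_rfl)
      have h0 : ∫ u in x..b, y u = 0 := by
        rw [intervalIntegral.integral_congr (g := fun _ => (0 : E3)),
          intervalIntegral.integral_zero]
        intro u hu
        rw [uIcc_of_le hxab.2] at hu
        refine hqb ?_
        rw [Real.dist_eq, abs_lt]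
        exact ⟨by linarith [hu.1, hx.1], by linarith [hu.2]⟩
      rw [h0, add_zero, hint] at hadd
      exact hadd

/-- The weak Euler-Lagrange equation. -/
lemma IsHolonomyConstrainedElastic.integral_eq_zero (hab : a < b) (hϱ : SmoothOnIcc a b ϱ)
    (hγ : IsCurve a b γ) (hs : IsArcLengthParam a b γ)
    (h : IsHolonomyConstrainedElastic a b ϱ γ) {T : ℝ → E3} (hT : T = unitTangent a b γ)
    {y : ℝ → E3} (hy : y ∈ testFields a b T) (hint : ∫ x in a..b, y x = 0)
    (hhol : ∫ x in a..b, inner ℝ (cross (T x) (y x)) (D a b T x) = (0 : ℝ)) :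
    ∫ x in a..b, inner ℝ (ϱ x • D a b (D a b T) x + D a b ϱ x • D a b T x) (y x) = (0 : ℝ) := by
  subst hT
  obtain ⟨hG, hD⟩ := isCompactlySupportedVariation_of_testField hab hγ hs hy hint
  obtain ⟨hys, hyT, hya, hyb⟩ := hy
  set G : ℝ → ℝ → E3 := fun t x => γ x + t • ∫ u in a..x, y u with hGdef
  have hvel : ∀ x ∈ Icc a b, HasDerivAt (fun t => D a b (G t) x) (y x) 0 := by
    intro x hx
    have e : (fun t => D a b (G t) x) = fun t => D a b γ x + t • y x := by
      funext t; exact hD t x hx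
    rw [e]
    exact (((hasDerivAt_id (0 : ℝ)).smul_const (y x)).const_add _).congr_deriv (by simp)
  have hc : ConstrainsArcLength a b G := by
    intro x hx
    have hn := hG.norm_D_zero hs hx
    have h1 := (hvel x hx).norm_sq.sqrt (by rw [hn]; norm_num)
    simp only [Real.sqrt_sq (norm_nonneg _)] at h1
    refine h1.congr_deriv ?_
    rw [D_congr hG.start hx, ← unitTangent_eq_D hs hx, hyT x hx]
    simp
  have hyeq : ∀ x ∈ Icc a b, tangentVariation a b 1 G x = y x := fun x hx =>
    (hG.hasDerivAt_velocity hab hs hc hx).unique (hvel x hx)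
  have hh : ConstrainsHolonomy a b G := by
    rw [hG.constrainsHolonomy_iff hab hγ, ← hhol]
    exact integral_congr_Icc hab fun x hx => by rw [hyeq x hx]
  have h0 := (hG.hasDerivAt_bendingEnergy hab hs hc hϱ).unique (h 1 G hG hc hh)
  rw [integral_congr_Icc hab (fun x hx => by rw [D_congr hyeq hx]),
    integral_bending hab (hγ.smoothOnIcc_unitTangent hab) hϱ hys hya.self_of_nhds
      hyb.self_of_nhds] at h0
  linarith

/-- The pairing of test fields with a fixed smooth field. -/
noncomputable def testPairing (hab : a < b) (T : ℝ → E3) {u : ℝ → E3} (hu : SmoothOnIcc a b u) :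
    testFields a b T →ₗ[ℝ] ℝ where
  toFun y := ∫ x in a..b, inner ℝ (u x) (y.1 x)
  map_add' y z := by
    rw [← intervalIntegral.integral_add ((hu.inner y.2.1).intervalIntegrable hab)
      ((hu.inner z.2.1).intervalIntegrable hab)]
    simp only [Submodule.coe_add, Pi.add_apply, inner_add_right]
  map_smul' c y := by
    simp only [Submodule.coe_smul, Pi.smul_apply, real_inner_smul_right,
      intervalIntegral.integral_const_mul, RingHom.id_apply, smul_eq_mul]

/-- The fundamental lemma of the calculus of variations for normal fields. -/
lemma normal_part_eq_zero_of_integral_eq_zero (hab : a < b) {T W : ℝ → E3}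
    (hT : SmoothOnIcc a b T) (hT1 : ∀ x ∈ Icc a b, ‖T x‖ = 1) (hW : SmoothOnIcc a b W)
    (h : ∀ y ∈ testFields a b T, ∫ x in a..b, inner ℝ (W x) (y x) = (0 : ℝ)) {x : ℝ}
    (hx : x ∈ Icc a b) : W x - inner ℝ (W x) (T x) • T x = 0 := by
  set w : ℝ → E3 := fun x => W x - inner ℝ (W x) (T x) • T x with hw
  have hws : SmoothOnIcc a b w := ContDiffOn.sub hW (ContDiffOn.smul (hW.inner hT) hT)
  have hTw : ∀ x ∈ Icc a b, inner ℝ (T x) (w x) = (0 : ℝ) := by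
    intro x hx
    simp only [hw, inner_sub_right, real_inner_smul_right, real_inner_self_eq_norm_sq, hT1 x hx,
      real_inner_comm (T x) (W x)]
    ring
  have hWw : ∀ x ∈ Icc a b, inner ℝ (W x) (w x) = (inner ℝ (w x) (w x) : ℝ) := by
    intro x hx
    have e : W x = w x + inner ℝ (W x) (T x) • T x := by simp [hw]
    conv_lhs => rw [e]
    rw [inner_add_left, real_inner_smul_left, hTw x hx]
    ring
  have hcont : ContinuousOn (fun x => (inner ℝ (w x) (w x) : ℝ)) (Icc a b) :=
    (hws.inner hws).continuousOn
  -- The test fields are `g • w` with `g` a bump function in the open interval and `w` the normal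
  -- part of `W`; they pair with `W` to `g |w|²`. Continuity extends the conclusion from almost
  -- every point to the closed interval.
  have hae : ∀ᵐ x ∂MeasureTheory.volume, x ∈ Ioo a b → (inner ℝ (w x) (w x) : ℝ) = 0 := by
    refine isOpen_Ioo.ae_eq_zero_of_integral_contDiff_smul_eq_zero
      ((hcont.mono Ioo_subset_Icc_self).locallyIntegrableOn measurableSet_Ioo) ?_
    intro g hg _ hgs
    have hnear : ∀ c, c ∉ Ioo a b → ∀ᶠ x in 𝓝 c, g x = 0 := fun c hc =>
      notMem_tsupport_iff_eventuallyEq.1 fun hcs => hc (hgs hcs)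
    have hmem : (fun x => g x • w x) ∈ testFields a b T := by
      refine ⟨hg.contDiffOn.smul hws, fun x hx => ?_, ?_, ?_⟩
      · rw [real_inner_smul_right, hTw x hx, mul_zero]
      · filter_upwards [hnear a (by simp)] with x hx
        rw [hx, zero_smul]
      · filter_upwards [hnear b (by simp)] with x hx
        rw [hx, zero_smul]
    have h0 := h _ hmem
    rw [integral_congr_Icc hab (g := fun x => g x • (inner ℝ (w x) (w x) : ℝ))
      (fun x hx => by rw [real_inner_smul_right, hWw x hx, smul_eq_mul]),
      intervalIntegral.integral_of_le hab.le] at h0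
    rw [← h0]
    refine (MeasureTheory.setIntegral_eq_integral_of_forall_compl_eq_zero fun x hx => ?_).symm
    rw [(hnear x fun hx' => hx (Ioo_subset_Ioc_self hx')).self_of_nhds, zero_smul]
  have hae' : (fun x => (inner ℝ (w x) (w x) : ℝ)) =ᵐ[MeasureTheory.volume.restrict (Icc a b)]
      fun _ => 0 := by
    rw [← MeasureTheory.Measure.restrict_congr_set MeasureTheory.Ioo_ae_eq_Icc]
    exact (MeasureTheory.ae_restrict_iff' measurableSet_Ioo).2 hae
  exact inner_self_eq_zero.1
    (MeasureTheory.Measure.eqOn_Icc_of_ae_eq MeasureTheory.volume hab.ne hae' hcont continuousOn_const hx)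

theorem IsHolonomyConstrainedElastic.normal_part (hab : a < b) (hϱ : SmoothOnIcc a b ϱ)
    (hγ : IsCurve a b γ) (hs : IsArcLengthParam a b γ)
    (h : IsHolonomyConstrainedElastic a b ϱ γ) {T : ℝ → E3} (hT : T = unitTangent a b γ) :
    ∃ (μ : ℝ) (α : E3), ∀ x ∈ Icc a b,
        ϱ x • D a b (D a b T) x
          - (ϱ x * inner ℝ (D a b (D a b T) x) (T x)) • T x
          + D a b ϱ x • D a b T x + α - inner ℝ α (T x) • T x
          - μ • cross (T x) (D a b T x) = 0 := by
  have hTs : SmoothOnIcc a b T := hT ▸ hγ.smoothOnIcc_unitTangent hab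
  have hT1 : ∀ x ∈ Icc a b, ‖T x‖ = 1 := fun x hx => hT ▸ hγ.norm_unitTangent hx
  have hT' := hTs.derivWithin hab
  set U : ℝ → E3 := fun x => ϱ x • D a b (D a b T) x + D a b ϱ x • D a b T x with hU
  have hUs : SmoothOnIcc a b U := ContDiffOn.add (ContDiffOn.smul hϱ (hT'.derivWithin hab))
    (ContDiffOn.smul (hϱ.derivWithin hab) hT')
  set B : ℝ → E3 := fun x => cross (T x) (D a b T x) with hB
  have hBs : SmoothOnIcc a b B := ContDiffOn.cross hTs hT'
  set e : Fin 3 → E3 := fun i => EuclideanSpace.single i 1 with he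
  have hes : ∀ i, SmoothOnIcc a b (fun _ => e i) := fun i => contDiffOn_const
  -- The constraint functionals: `none` is the holonomy up to sign, and `some i` is the `i`-th
  -- coordinate of `∫ y`.
  let L : Option (Fin 3) → testFields a b T →ₗ[ℝ] ℝ := fun o =>
    o.elim (testPairing hab T hBs) fun i => testPairing hab T (hes i)
  have hker : ⨅ i, LinearMap.ker (L i) ≤ LinearMap.ker (testPairing hab T hUs) := by
    intro y hy
    rw [Submodule.mem_iInf] at hy
    refine h.integral_eq_zero hab hϱ hγ hs hT y.2 ?_ ?_
    · ext i
      have h1 : ∫ x in a..b, inner ℝ (e i) (y.1 x) = (0 : ℝ) := hy (some i)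
      rw [inner_integral hab y.2.1] at h1
      simpa [he, EuclideanSpace.inner_single_left] using h1
    · have h1 : ∫ x in a..b, inner ℝ (B x) (y.1 x) = (0 : ℝ) := hy none
      rw [← neg_eq_zero, ← intervalIntegral.integral_neg, ← h1]
      refine integral_congr_Icc hab fun x _ => ?_
      rw [hB, inner_cross_rotate, inner_cross_swap, inner_cross_rotate, inner_cross_rotate,
        neg_neg]
  -- Lagrange multipliers: a functional that vanishes on the common kernel of finitely many
  -- functionals is a combination of them.
  obtain ⟨c, hc⟩ := (Submodule.mem_span_range_iff_exists_fun ℝ).1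
    (mem_span_of_iInf_ker_le_ker hker)
  refine ⟨c none, -∑ i, c (some i) • e i, fun x hx => ?_⟩
  set α : E3 := ∑ i, c (some i) • e i with hα
  have hpair : ∀ y ∈ testFields a b T,
      ∫ x in a..b, inner ℝ (U x + -α - c none • B x) (y x) = (0 : ℝ) := by
    intro y hy
    have h1 := congrArg (fun K : testFields a b T →ₗ[ℝ] ℝ => K ⟨y, hy⟩) hc
    simp only [Fintype.sum_option, LinearMap.add_apply, LinearMap.sum_apply,
      LinearMap.smul_apply, smul_eq_mul] at h1
    change c none * (∫ x in a..b, inner ℝ (B x) (y x)) +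
      ∑ i, c (some i) * (∫ x in a..b, inner ℝ (e i) (y x)) =
      ∫ x in a..b, (inner ℝ (U x) (y x) : ℝ) at h1
    have h2 : ∑ i, c (some i) * (∫ x in a..b, inner ℝ (e i) (y x)) =
        ∫ x in a..b, (inner ℝ α (y x) : ℝ) := by
      rw [inner_integral hab hy.1, hα, sum_inner]
      refine Finset.sum_congr rfl fun i _ => ?_
      rw [inner_integral hab hy.1, real_inner_smul_left]
    have hi1 := (hUs.inner hy.1).intervalIntegrable hab
    have hi2 := (SmoothOnIcc.inner (f := fun _ => α) contDiffOn_const hy.1).intervalIntegrable hab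
    have hi3 := ((hBs.inner hy.1).intervalIntegrable hab).const_mul (c none)
    simp only [inner_sub_left, real_inner_smul_left, ← sub_eq_add_neg]
    rw [intervalIntegral.integral_sub (hi1.sub hi2) hi3, intervalIntegral.integral_sub hi1 hi2,
      intervalIntegral.integral_const_mul]
    linarith
  have hz := normal_part_eq_zero_of_integral_eq_zero hab hTs hT1
    (ContDiffOn.sub (ContDiffOn.add hUs contDiffOn_const) (ContDiffOn.const_smul (c none) hBs))
    hpair hx
  have hT0 : inner ℝ (D a b T x) (T x) = (0 : ℝ) := by
    rw [real_inner_comm]; exact inner_D_self_eq_zero hab hTs hT1 hx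
  simp only [hU, hB, inner_sub_left, inner_add_left, real_inner_smul_left, hT0,
    inner_cross_self_left, mul_zero, add_zero, sub_zero] at hz
  rw [← hz]
  module

end Necessity
end ElasticCurve

/-! ### The equivalence of the five statements. -/

open ElasticCurve
theorem theorem4p1 (a b : ℝ) (hab : a < b) (ϱ : ℝ → ℝ) (hϱ : IsBendingStiffness a b ϱ)
    (γ : ℝ → E3) (hγ : IsCurve a b γ) (hs : IsArcLengthParam a b γ)
    (T : ℝ → E3) (hT : T = unitTangent a b γ) :
    List.TFAE [
      IsHolonomyConstrainedElastic a b ϱ γ,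
      ∃ (Λ : ℝ → ℝ) (μ : ℝ) (α : E3), SmoothOnIcc a b Λ ∧ ∀ x ∈ Icc a b,
        ϱ x • D a b (D a b T) x
          + ((3 / 2 : ℝ) * ϱ x * inner ℝ (D a b T x) (D a b T x)) • T x
          + D a b ϱ x • D a b T x - Λ x • T x - μ • cross (T x) (D a b T x) + α = 0,
      ∃ (μ : ℝ) (α : E3), ∀ x ∈ Icc a b,
        ϱ x • D a b (D a b T) x
          - (ϱ x * inner ℝ (D a b (D a b T) x) (T x)) • T x
          + D a b ϱ x • D a b T x + α - inner ℝ α (T x) • T x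
          - μ • cross (T x) (D a b T x) = 0,
      ∃ (μ : ℝ) (α β : E3), ∀ x ∈ Icc a b,
        ϱ x • cross (D a b γ x) (D a b (D a b γ) x) = -(μ • T x) + cross α (γ x) + β,
      ∃ α β : E3, ∀ x ∈ Icc a b,
        ϱ x • D a b (D a b γ) x = cross (cross α (γ x) + β) (D a b γ x)] := by
  have hTs : SmoothOnIcc a b T := hT ▸ hγ.smoothOnIcc_unitTangent hab
  have hT1 : ∀ x ∈ Icc a b, ‖T x‖ = 1 := fun x hx => hT ▸ hγ.norm_unitTangent hx
  have hTD : EqOn T (D a b γ) (Icc a b) := hT ▸ unitTangent_eq_D hs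
  have hTDD := D_congr hTD
  have hγ' : ∀ x ∈ Icc a b, HasDerivWithinAt γ (T x) (Icc a b) x := fun x hx => by
    rw [hTD hx]; exact hγ.1.hasDerivWithinAt hx
  tfae_have 1 → 3 := fun h => h.normal_part hab hϱ.1 hγ hs hT
  tfae_have 3 → 1 := fun ⟨_, _, h⟩ =>
    isHolonomyConstrainedElastic_of_normal_part hab hϱ.1 hγ hs hT h
  tfae_have 2 ↔ 3 := euler_lagrange_iff_normal_part hab hTs hT1 hϱ.1
  tfae_have 3 ↔ 4 := by
    refine exists_congr fun μ => exists_congr fun α => ?_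
    rw [normal_part_iff_first_integral hab hTs hT1 hϱ.1 hγ']
    refine exists_congr fun β => forall₂_congr fun x hx => ?_
    rw [hTDD hx, hTD hx]
  tfae_have 4 ↔ 5 := by
    -- With `𝐚` and `𝐛` outermost, the two statements are equivalent for each fixed pair, and only
    -- `μ` has to be found.
    rw [exists_comm]
    refine exists_congr fun α => ?_
    rw [exists_comm]
    refine exists_congr fun β => ?_
    have h := first_integral_iff_rotation hab hTs hT1 hϱ.2 hγ' α β
    refine Iff.trans (exists_congr fun μ => forall₂_congr fun x hx => ?_)
      (h.trans (forall₂_congr fun x hx => ?_))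
    · rw [hTDD hx, hTD hx]
    · rw [hTDD hx, hTD hx]
  tfae_finish
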